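/- Let $V$ be a $6$-dimensional vector space over an arbitrary field $\mathbb K$, with a basis $(e_1,\dots,e_6)$ and dual basis $(e^1,\dots,e^6)$, and write $\underline{ijk}=e^i\wedge e^j\wedge e^k\in(\bigwedge^3V)^*$. Let $h$ be a non-zero linear functional of $\bigwedge^3V$, let $\chi(x,y,z)=h(x\wedge y\wedge z)$ be the associated alternating form, $\mathrm{Rad}(\chi)=\{v:\chi(x,y,v)=0\ \forall x,y\in V\}$, and let the rank of $h$ be the codimension of $\mathrm{Rad}(\chi)$ in $V$. Let $H$ be the set of $3$-dimensional subspaces of $V$ on which $\chi$ vanishes identically, and let $R^\uparrow(H)$ (respectively $R_\downarrow(H)$) be the set of $2$-dimensional (respectively $1$-dimensional) subspaces of $V$ all of whose $3$-dimensional overspaces belong to $H$. Two alternating forms are nearly equivalent if each of them is, up to the action of $\mathrm{GL}(V)$, a non-zero scalar multiple of the other; $h$ has a given type if $\chi$ is nearly equivalent to the form associated to the functional displayed for that type: - $T_1$: $\underline{123}$; - $T_2$: $\underline{123}+\underline{145}$; - $T_3$: $\underline{123}+\underline{456}$; - $T_4$: $\underline{162}+\underline{243}+\underline{135}$; - $T^{(1)}_{10,\lambda}$: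 $\underline{123}+\lambda(\underline{156}+\underline{345}+\underline{426})$, where $\lambda\in\mathbb K$ is such that $t^2-\lambda$ is irreducible in $\mathbb K[t]$; - $T^{(2)}_{10,\lambda}$: $\underline{126}+\underline{153}+\underline{234}+(\lambda^2+1)\underline{456}+\lambda(\underline{156}+\underline{345}+\underline{426})$, where $\mathrm{char}(\mathbb K)=2$ and $\lambda\in\mathbb K$ is such that $t^2+\lambda t+1$ is irreducible in $\mathbb K[t]$. If $V=V_0\oplus V_1$ with $V_1\neq 0$ and $H_0$ is the set of $3$-subspaces of $V_0$ on which a non-zero alternating $3$-linear form $\varphi_0$ on $V_0$ vanishes identically, the trivial extension $H_0\odot V_1$ is the set of $3$-subspaces of $V$ on which the form $\varphi_0(\pi x,\pi y,\pi z)$ vanishes identically, where $\pi:V\to V_0$ is the projection along $V_1$. If $\dim V_0=3$ (so that $H_0=\emptyset$), it is called the trivial hyperplane centered at $V_1$. If $V_0$ is a hyperplane of $V'$ and $H_0$ is a set of $2$-subspaces of $V_0$, the expansion $E(H_0)$ is the set of $3$-subspaces $X$ of $V'$ with $X\subseteq V_0$ or $X\cap V_0\in H_0$. Then $h$ has at least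 one of the types $T_1,T_2,T_3,T_4,T^{(1)}_{10,\lambda},T^{(2)}_{10,\lambda}$, and the following hold. 1. If $h$ has type $T_1$, then $h$ has rank $3$, $H$ is the trivial hyperplane centered at $\mathrm{Rad}(\chi)$, and $R^\uparrow(H)$ is the set of $2$-subspaces of $V$ that meet $\mathrm{Rad}(\chi)$ non-trivially. 2. If $h$ has type $T_2$, then $h$ has rank $5$, $\mathrm{Rad}(\chi)$ is $1$-dimensional and is the only element of $R_\downarrow(H)$. There are a complement $V'$ of $\mathrm{Rad}(\chi)$ in $V$, a $4$-dimensional subspace $V_0$ of $V'$ and a non-degenerate alternating bilinear form on $V_0$, whose set of totally isotropic $2$-subspaces (the line-set of a symplectic generalized quadrangle) we call $H_0$, such that $H=E(H_0)\odot\mathrm{Rad}(\chi)$, where $E(H_0)$ is the expansion of $H_0$ to $V'$, and $R^\uparrow(H)$ consists of the $2$-subspaces of $V$ that either contain $\mathrm{Rad}(\chi)$ or whose image under the projection of $V$ onto $V'$ along $\mathrm{Rad}(\chi)$ belongs to $H_0$. 3. If $h$ has type $T_3$, then $h$ has rank $6$ and there is a decomposition $V=V_1\oplus V_2$ with $\dim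 V_1=\dim V_2=3$ such that $R^\uparrow(H)=\{\langle x,y\rangle: x\in V_1\setminus\{0\},\ y\in V_2\setminus\{0\}\}$. 4. If $h$ has type $T_4$, then $h$ has rank $6$ and there are a decomposition $V=V_1\oplus V_2$ with $\dim V_1=\dim V_2=3$ and an isomorphism $\omega:V_1\to V_2$ such that $R^\uparrow(H)$ consists of the $2$-subspaces $\langle x+y,\omega(x)\rangle$ with $x\in V_1\setminus\{0\}$, $y\in V_2$, together with all $2$-subspaces of $V_2$. 5. If $h$ has type $T^{(1)}_{10,\lambda}$ or $T^{(2)}_{10,\lambda}$ for some $\lambda$, then $h$ has rank $6$ and $R^\uparrow(H)$ is a Desarguesian line spread of $\mathrm{PG}(V)$: every $1$-dimensional subspace of $V$ lies in exactly one member of $R^\uparrow(H)$, and there are a field extension $\mathbb L/\mathbb K$ of degree $2$ and an $\mathbb L$-vector space structure on $V$, extending its $\mathbb K$-vector space structure, such that the members of $R^\uparrow(H)$ are the $1$-dimensional $\mathbb L$-subspaces of $V$. -/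

import Mathlib

universe u v

namespace AltForm

noncomputable section

section General

variable {K : Type u} {V : Type v} [Field K] [AddCommGroup V] [Module K V]

/-- The alternating `k`-linear form `(v₁, …, vₖ) ↦ h (v₁ ∧ ⋯ ∧ vₖ)` associated to a linear
functional `h` of `⋀ᵏ V`. -/
def assocForm {k : ℕ} (h : Module.Dual K (⋀[K]^k V)) : V [⋀^Fin k]→ₗ[K] K :=
  h.compAlternatingMap (exteriorPower.ιMulti K k)

/-- The hyperplane of the `k`-Grassmannian of `V` defined by an alternating `k`-linear form:
the set of the `k`-dimensional subspaces on which the form vanishes identically. -/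
def formHyperplane {k : ℕ} (φ : V [⋀^Fin k]→ₗ[K] K) : Set (Submodule K V) :=
  {X | Module.finrank K X = k ∧ ∀ w : Fin k → V, (∀ i, w i ∈ X) → φ w = 0}

/-- The hyperplane of the `k`-Grassmannian of a subspace `W` of `V` defined by an alternating
`k`-linear form on `W`, its members being regarded as subspaces of `V`. -/
def subspaceHyperplane {k : ℕ} (W : Submodule K V) (φ : W [⋀^Fin k]→ₗ[K] K) :
    Set (Submodule K V) :=
  Submodule.map W.subtype '' formHyperplane φ

/-- The radical of an alternating form: the vectors `v` such that the form vanishes whenever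
one of its arguments (here the first one, which is the same up to sign) is `v`. -/
def formRadical {m : ℕ} (φ : V [⋀^Fin (m + 1)]→ₗ[K] K) : Submodule K V :=
  LinearMap.ker φ.curryLeft

/-- The rank of an alternating form: the codimension of its radical. -/
def formRank {m : ℕ} (φ : V [⋀^Fin (m + 1)]→ₗ[K] K) : ℕ :=
  Module.finrank K (V ⧸ formRadical φ)

/-- For a set `H` of `k`-dimensional subspaces of `V`, the set of the `i`-dimensional subspaces
all of whose `k`-dimensional overspaces belong to `H`. -/
def radicalOf (k i : ℕ) (H : Set (Submodule K V)) : Set (Submodule K V) :=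
  {X | Module.finrank K X = i ∧
    ∀ Y : Submodule K V, Module.finrank K Y = k → X ≤ Y → Y ∈ H}

/-- The upper radical of a hyperplane of the `3`-Grassmannian (a set of `2`-subspaces). -/
def upperRadical (H : Set (Submodule K V)) : Set (Submodule K V) := radicalOf 3 2 H

/-- The lower radical of a hyperplane of the `3`-Grassmannian (a set of `1`-subspaces). -/
def lowerRadical (H : Set (Submodule K V)) : Set (Submodule K V) := radicalOf 3 1 H

/-- `H` is the trivial extension `H₀ ⊙ V₁` of the hyperplane `H₀` of the `k`-Grassmannian of
`V₀`, where `V = V₀ ⊕ V₁`: a non-zero form `φ₀` on `V₀` defines `H₀`, and `H` is defined by the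
form on `V` that agrees with `φ₀` on `V₀` and vanishes when one of the arguments is in `V₁`. -/
def IsTrivialExtension (k : ℕ) (H : Set (Submodule K V)) (V₀ V₁ : Submodule K V)
    (H₀ : Set (Submodule K V)) : Prop :=
  V₁ ≠ ⊥ ∧ ∃ (hc : IsCompl V₀ V₁) (φ₀ : V₀ [⋀^Fin k]→ₗ[K] K),
    φ₀ ≠ 0 ∧ H₀ = subspaceHyperplane V₀ φ₀ ∧
    H = formHyperplane (φ₀.compLinearMap (V₀.projectionOnto V₁ hc))

/-- `H` is the trivial hyperplane of the `k`-Grassmannian of `V` centered at `V₁`: the trivial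
extension by `V₁` of the empty hyperplane of a `k`-dimensional complement of `V₁`. -/
def IsTrivialHyperplane (k : ℕ) (H : Set (Submodule K V)) (V₁ : Submodule K V) : Prop :=
  ∃ V₀ : Submodule K V, Module.finrank K V₀ = k ∧ IsTrivialExtension k H V₀ V₁ ∅

/-- The expansion `E(H₀)` to the `k`-Grassmannian of the subspace `V'` of a set `H₀` of
`(k-1)`-dimensional subspaces of a hyperplane `V₀` of `V'`. -/
def expansion (k : ℕ) (V' V₀ : Submodule K V) (H₀ : Set (Submodule K V)) :
    Set (Submodule K V) :=
  {X | X ≤ V' ∧ Module.finrank K X = k ∧ (X ≤ V₀ ∨ X ⊓ V₀ ∈ H₀)}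

/-- Two alternating forms are equivalent when they differ by an element of `GL(V)`. -/
def Equivalent {k : ℕ} (φ ψ : V [⋀^Fin k]→ₗ[K] K) : Prop :=
  ∃ g : V ≃ₗ[K] V, ∀ w : Fin k → V, ψ w = φ (fun i => g (w i))

/-- Two alternating forms are nearly equivalent when each of them is equivalent to a non-zero
scalar multiple of the other. -/
def NearlyEquivalent {k : ℕ} (φ ψ : V [⋀^Fin k]→ₗ[K] K) : Prop :=
  (∃ c : K, c ≠ 0 ∧ Equivalent φ (c • ψ)) ∧ (∃ c : K, c ≠ 0 ∧ Equivalent ψ (c • φ))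

/-- A line spread of `PG(V)`: a set of `2`-dimensional subspaces such that every
`1`-dimensional subspace is contained in exactly one of them. -/
def IsLineSpread (S : Set (Submodule K V)) : Prop :=
  (∀ X ∈ S, Module.finrank K X = 2) ∧
    ∀ p : Submodule K V, Module.finrank K p = 1 → ∃! X, X ∈ S ∧ p ≤ X

/-- A Desarguesian line spread of `PG(V)`: for some quadratic extension field `L` of `K` and
some `L`-vector space structure on `V` extending the given `K`-structure, the members of the
spread are the `1`-dimensional `L`-subspaces of `V`. -/
def IsDesarguesianLineSpread (S : Set (Submodule K V)) : Prop :=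
  IsLineSpread S ∧
    ∃ (L : Type u) (_ : Field L) (_ : Algebra K L) (_ : Module L V) (_ : IsScalarTower K L V),
      Module.finrank K L = 2 ∧
        S = {X | ∃ x : V, x ≠ 0 ∧ X = (Submodule.span L {x}).restrictScalars K}

end General

section Types

variable {K : Type u} {V : Type v} [Field K] [AddCommGroup V] [Module K V]
variable (E : Module.Basis (Fin 6) K V)

/-- The functional `eⁱ ∧ eʲ ∧ eᵏ` of `⋀³ V`, for the dual basis `(eⁱ)` of `E`. -/
def wedge (i j k : Fin 6) : Module.Dual K (⋀[K]^3 V) :=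
  exteriorPower.pairingDual K V 3
    (exteriorPower.ιMulti K 3 ![E.coord i, E.coord j, E.coord k])

/-! The model functionals. The basis vectors `e₁, …, e₆` are `E 0, …, E 5`, so that, for
instance, `e¹ ∧ e² ∧ e³` is `wedge E 0 1 2`. -/

/-- `123` -/
def modelT1 : Module.Dual K (⋀[K]^3 V) := wedge E 0 1 2

/-- `123 + 145` -/
def modelT2 : Module.Dual K (⋀[K]^3 V) := wedge E 0 1 2 + wedge E 0 3 4

/-- `123 + 456` -/
def modelT3 : Module.Dual K (⋀[K]^3 V) := wedge E 0 1 2 + wedge E 3 4 5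

/-- `162 + 243 + 135` -/
def modelT4 : Module.Dual K (⋀[K]^3 V) := wedge E 0 5 1 + wedge E 1 3 2 + wedge E 0 2 4

/-- `123 + c (156 + 345 + 426)` -/
def modelT10₁ (c : K) : Module.Dual K (⋀[K]^3 V) :=
  wedge E 0 1 2 + c • (wedge E 0 4 5 + wedge E 2 3 4 + wedge E 3 1 5)

/-- `126 + 153 + 234 + (c² + 1) 456 + c (156 + 345 + 426)` -/
def modelT10₂ (c : K) : Module.Dual K (⋀[K]^3 V) :=
  wedge E 0 1 5 + wedge E 0 4 2 + wedge E 1 2 3 + (c ^ 2 + 1) • wedge E 3 4 5 +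
    c • (wedge E 0 4 5 + wedge E 2 3 4 + wedge E 3 1 5)

/-- Near equivalence of functionals, as near equivalence of the associated forms. -/
def SameType (h h' : Module.Dual K (⋀[K]^3 V)) : Prop :=
  NearlyEquivalent (assocForm h) (assocForm h')

def HasTypeT1 (h : Module.Dual K (⋀[K]^3 V)) : Prop := SameType h (modelT1 E)

def HasTypeT2 (h : Module.Dual K (⋀[K]^3 V)) : Prop := SameType h (modelT2 E)

def HasTypeT3 (h : Module.Dual K (⋀[K]^3 V)) : Prop := SameType h (modelT3 E)

def HasTypeT4 (h : Module.Dual K (⋀[K]^3 V)) : Prop := SameType h (modelT4 E)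

open Polynomial in
def HasTypeT10₁ (c : K) (h : Module.Dual K (⋀[K]^3 V)) : Prop :=
  Irreducible (X ^ 2 - C c : K[X]) ∧ SameType h (modelT10₁ E c)

open Polynomial in
def HasTypeT10₂ (c : K) (h : Module.Dual K (⋀[K]^3 V)) : Prop :=
  CharP K 2 ∧ Irreducible (X ^ 2 + C c * X + 1 : K[X]) ∧ SameType h (modelT10₂ E c)

end Types

end

end AltForm

open AltForm

/-!
# Alternating trilinear forms in dimension six

Write `t x y z = h (x ∧ y ∧ z)`. A `2`-subspace `⟨x, y⟩` belongs to the upper radical of the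
hyperplane of `t` if and only if `t x y · = 0` (`span_pair_mem_upperRadical_iff`), since any third
vector lies in a common `3`-dimensional overspace. All the sets to be determined are therefore
described by the kernels of the contractions `t x`, and these can be computed on the models.

*The models.* With respect to a basis, split the coordinates of a vector into two triples, as
`x + x'`. Apart from `T₂`, each model is a combination of `[x y z]`, of the sums
`[x y z'] + ⋯` and `[x y' z'] + ⋯`, and of `[x' y' z']` (`IsCubic`), where `[x y z]` is the triple
product. So `t x y = 0` amounts to the vanishing of two combinations of cross products. For `T₁`,
`T₃`, `T₄` this is solved by hand. For the two `T₁₀` models the coefficients are the values of a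
`K`-linear functional `ℓ` at the powers of a generator of the quadratic extension `L`, so the form
is `ℓ ∘ det` on `V ≃ L³` (`IsCubic.tri_eq_functional_det`) and `t x y = 0` means that `x` and `y`
are proportional over `L`; this is the Desarguesian spread (`isDesarguesianLineSpread_of_det`).
The type `T₂` is `e¹` times a symplectic form on four coordinates.

*The classification.* Suppose first that some contraction `t v` has rank two, say it is the product
of the functionals dual to `p` and `q` (`IsRankTwo`). On the canonical complement of `⟨v, p, q⟩`,
which is three-dimensional, what remains of `t` is a trilinear form and the two bilinear forms
`t p`, `t q`. If the trilinear form is not zero, the bilinear forms can be removed by translating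
`p` and `q`, and `t` has type `T₃`; otherwise `t` has type `T₁`, `T₂` or `T₄` according to the
dimension of the span of the two bilinear forms (`IsRankTwo.hasModel`).

Suppose now that no contraction has rank two. Then `t` has no radical, because a form on
a four-dimensional space has one (`tri_ne_zero_of_not_isRankTwo`), so all `t x` with `x ≠ 0` have
rank four and the kernels of the `t x` form a line spread. For two members `A`, `B` of it, all
functionals `t x y` with `x, y ∈ A ⊕ B` lie in the two-dimensional annihilator of `A ⊕ B`. So `t`
gives a multiplication `A × B → K²` without zero divisors, and a third member of the spread is
a complement of `A ⊕ B`. Hence the form is given by a quadratic polynomial without roots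
(`exists_isQuadratic`). The choice of a generator of trace zero, or in characteristic two of
a generator of norm one when the trace is not zero, leads to the two `T₁₀` models
(`exists_modelT10`).
-/

namespace AltForm

open Matrix

variable {K : Type u} {V : Type v} [Field K] [AddCommGroup V] [Module K V]

/-! ### Alternating trilinear forms as curried maps -/

theorem update_vec₀ {α : Type*} (x y z a : α) : Function.update ![x, y, z] 0 a = ![a, y, z] := by
  funext i; fin_cases i <;> rfl

theorem update_vec₁ {α : Type*} (x y z a : α) : Function.update ![x, y, z] 1 a = ![x, a, z] := by
  funext i; fin_cases i <;> rfl

theorem update_vec₂ {α : Type*} (x y z a : α) : Function.update ![x, y, z] 2 a = ![x, y, a] := by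
  funext i; fin_cases i <;> rfl

/-- An alternating trilinear form, as a curried linear map of three arguments. -/
noncomputable def tri (φ : V [⋀^Fin 3]→ₗ[K] K) : V →ₗ[K] V →ₗ[K] V →ₗ[K] K :=
  LinearMap.mk₂ K
    (fun x y =>
      { toFun := fun z => φ ![x, y, z]
        map_add' := fun z z' => by
          have := φ.map_update_add ![x, y, 0] 2 z z'
          rwa [update_vec₂, update_vec₂, update_vec₂] at this
        map_smul' := fun c z => by
          have := φ.map_update_smul ![x, y, 0] 2 c z
          rwa [update_vec₂, update_vec₂] at this })
    (fun x x' y => by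
      ext z
      have := φ.map_update_add ![0, y, z] 0 x x'
      rwa [update_vec₀, update_vec₀, update_vec₀] at this)
    (fun c x y => by
      ext z
      have := φ.map_update_smul ![0, y, z] 0 c x
      rwa [update_vec₀, update_vec₀] at this)
    (fun x y y' => by
      ext z
      have := φ.map_update_add ![x, 0, z] 1 y y'
      rwa [update_vec₁, update_vec₁, update_vec₁] at this)
    (fun c x y => by
      ext z
      have := φ.map_update_smul ![x, 0, z] 1 c y
      rwa [update_vec₁, update_vec₁] at this)

theorem tri_apply (φ : V [⋀^Fin 3]→ₗ[K] K) (x y z : V) : tri φ x y z = φ ![x, y, z] := rfl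

theorem apply_eq_tri (φ : V [⋀^Fin 3]→ₗ[K] K) (w : Fin 3 → V) :
    φ w = tri φ (w 0) (w 1) (w 2) := by
  rw [tri_apply]
  congr 1
  ext i
  fin_cases i <;> rfl

/-- A curried trilinear form that vanishes when two of its arguments are equal. -/
structure IsAlt₃ (t : V →ₗ[K] V →ₗ[K] V →ₗ[K] K) : Prop where
  left : ∀ x z, t x x z = 0
  right : ∀ x y, t x y y = 0

namespace IsAlt₃

variable {t : V →ₗ[K] V →ₗ[K] V →ₗ[K] K} (ht : IsAlt₃ t)
include ht

theorem swap₁₂ (x y z : V) : t x y z = -t y x z := by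
  have := ht.left (x + y) z
  simp only [map_add, LinearMap.add_apply, ht.left] at this
  linear_combination this

theorem swap₂₃ (x y z : V) : t x y z = -t x z y := by
  have := ht.right x (y + z)
  simp only [map_add, LinearMap.add_apply, ht.right] at this
  linear_combination this

theorem swap₁₃ (x y z : V) : t x y z = -t z y x := by
  rw [ht.swap₁₂, ht.swap₂₃, ht.swap₁₂, neg_neg]

theorem rotate (x y z : V) : t x y z = t y z x := by
  rw [ht.swap₁₂, ht.swap₂₃, neg_neg]

theorem outer (x y : V) : t x y x = 0 := by rw [ht.swap₂₃, ht.left, neg_zero]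

end IsAlt₃

theorem isAlt₃_tri (φ : V [⋀^Fin 3]→ₗ[K] K) : IsAlt₃ (tri φ) where
  left x z := φ.map_eq_zero_of_eq ![x, x, z] (i := 0) (j := 1) rfl (by decide)
  right x y := φ.map_eq_zero_of_eq ![x, y, y] (i := 1) (j := 2) rfl (by decide)

theorem tri_smul (c : K) (φ : V [⋀^Fin 3]→ₗ[K] K) : tri (c • φ) = c • tri φ := by
  ext x y z; simp [tri_apply]

theorem tri_eq_zero_iff (φ : V [⋀^Fin 3]→ₗ[K] K) : tri φ = 0 ↔ φ = 0 := by
  constructor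
  · intro h
    ext w
    rw [apply_eq_tri, h]; simp
  · rintro rfl
    ext x y z; simp [tri_apply]

/-- An alternating trilinear form is determined by its values on the increasing triples of
vectors of a basis. -/
theorem ext_increasing {n : ℕ} (B : Module.Basis (Fin n) K V) {φ ψ : V [⋀^Fin 3]→ₗ[K] K}
    (H : ∀ i j k, i < j → j < k → tri φ (B i) (B j) (B k) = tri ψ (B i) (B j) (B k)) :
    φ = ψ := by
  refine Module.Basis.ext_alternating B fun v hv => ?_
  have hs : StrictMono (v ∘ Tuple.sort v) :=
    (Tuple.monotone_sort v).strictMono_of_injective (hv.comp (Tuple.sort v).injective)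
  have key := H _ _ _ (hs (show (0 : Fin 3) < 1 by decide)) (hs (show (1 : Fin 3) < 2 by decide))
  have h1 := φ.map_perm (fun i => B (v i)) (Tuple.sort v)
  have h2 := ψ.map_perm (fun i => B (v i)) (Tuple.sort v)
  have h3 : φ ((fun i => B (v i)) ∘ Tuple.sort v) = ψ ((fun i => B (v i)) ∘ Tuple.sort v) := by
    rw [apply_eq_tri, apply_eq_tri]
    exact key
  rw [h1, h2] at h3
  rcases Int.units_eq_one_or (Equiv.Perm.sign (Tuple.sort v)) with hs | hs <;>
    simpa [hs] using h3

/-! ### The model functionals in coordinates -/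

theorem tri_wedge (E : Module.Basis (Fin 6) K V) (i j k : Fin 6) (x y z : V) :
    tri (assocForm (wedge E i j k)) x y z =
      E.repr x i * (E.repr y j * E.repr z k - E.repr y k * E.repr z j) +
      E.repr x j * (E.repr y k * E.repr z i - E.repr y i * E.repr z k) +
      E.repr x k * (E.repr y i * E.repr z j - E.repr y j * E.repr z i) := by
  simp only [tri_apply, assocForm, wedge, LinearMap.compAlternatingMap_apply,
    exteriorPower.pairingDual_ιMulti_ιMulti, Matrix.det_fin_three, Matrix.of_apply]
  simp
  ring

theorem assocForm_add {k : ℕ} (h h' : Module.Dual K (⋀[K]^k V)) :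
    assocForm (h + h') = assocForm h + assocForm h' := rfl

theorem assocForm_smul {k : ℕ} (c : K) (h : Module.Dual K (⋀[K]^k V)) :
    assocForm (c • h) = c • assocForm h := rfl

theorem assocForm_injective {k : ℕ} :
    Function.Injective (assocForm : Module.Dual K (⋀[K]^k V) → V [⋀^Fin k]→ₗ[K] K) := by
  intro h h' e
  exact exteriorPower.linearMap_ext e

theorem tri_add (φ ψ : V [⋀^Fin 3]→ₗ[K] K) : tri (φ + ψ) = tri φ + tri ψ := by
  ext x y z; simp [tri_apply]

/-- A functional depending on a basis is natural when it is transported by `GL(V)` together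
with the basis. -/
def IsNatural (M : Module.Basis (Fin 6) K V → Module.Dual K (⋀[K]^3 V)) : Prop :=
  ∀ (E : Module.Basis (Fin 6) K V) (g : V ≃ₗ[K] V) (x y z : V),
    tri (assocForm (M (E.map g))) (g x) (g y) (g z) = tri (assocForm (M E)) x y z

theorem isNatural_wedge (i j k : Fin 6) :
    IsNatural fun E : Module.Basis (Fin 6) K V => wedge E i j k := by
  intro E g x y z
  simp [tri_wedge]

theorem IsNatural.add {M N : Module.Basis (Fin 6) K V → Module.Dual K (⋀[K]^3 V)}
    (hM : IsNatural M) (hN : IsNatural N) : IsNatural fun E => M E + N E := by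
  intro E g x y z
  simp [assocForm_add, tri_add, hM E g x y z, hN E g x y z]

theorem IsNatural.smul {M : Module.Basis (Fin 6) K V → Module.Dual K (⋀[K]^3 V)}
    (hM : IsNatural M) (c : K) : IsNatural fun E => c • M E := by
  intro E g x y z
  simp [assocForm_smul, tri_smul, hM E g x y z]

theorem isNatural_modelT1 : IsNatural (modelT1 (K := K) (V := V)) := isNatural_wedge _ _ _

theorem isNatural_modelT2 : IsNatural (modelT2 (K := K) (V := V)) :=
  (isNatural_wedge _ _ _).add (isNatural_wedge _ _ _)

theorem isNatural_modelT3 : IsNatural (modelT3 (K := K) (V := V)) :=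
  (isNatural_wedge _ _ _).add (isNatural_wedge _ _ _)

theorem isNatural_modelT4 : IsNatural (modelT4 (K := K) (V := V)) :=
  ((isNatural_wedge _ _ _).add (isNatural_wedge _ _ _)).add (isNatural_wedge _ _ _)

theorem isNatural_modelT10₁ (c : K) : IsNatural fun E : Module.Basis (Fin 6) K V => modelT10₁ E c :=
  (isNatural_wedge _ _ _).add
    ((((isNatural_wedge _ _ _).add (isNatural_wedge _ _ _)).add (isNatural_wedge _ _ _)).smul c)

theorem isNatural_modelT10₂ (c : K) : IsNatural fun E : Module.Basis (Fin 6) K V => modelT10₂ E c :=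
  ((((isNatural_wedge _ _ _).add (isNatural_wedge _ _ _)).add (isNatural_wedge _ _ _)).add
    ((isNatural_wedge _ _ _).smul _)).add
    ((((isNatural_wedge _ _ _).add (isNatural_wedge _ _ _)).add (isNatural_wedge _ _ _)).smul c)

/-- Being nearly equivalent to a natural model means being a multiple of the model taken in
some other basis. -/
theorem IsNatural.sameType_iff {M : Module.Basis (Fin 6) K V → Module.Dual K (⋀[K]^3 V)}
    (hM : IsNatural M) (E : Module.Basis (Fin 6) K V) (h : Module.Dual K (⋀[K]^3 V)) :
    SameType h (M E) ↔ ∃ (B : Module.Basis (Fin 6) K V) (c : K), c ≠ 0 ∧ h = c • M B := by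
  constructor
  · rintro ⟨⟨c, hc, g, hg⟩, -⟩
    refine ⟨E.map g, c, hc, assocForm_injective ?_⟩
    ext w
    have := hg fun i => g.symm (w i)
    simp only [LinearEquiv.apply_symm_apply] at this
    rw [← this, AlternatingMap.smul_apply, assocForm_smul, AlternatingMap.smul_apply,
      apply_eq_tri _ w, apply_eq_tri]
    have := hM E g (g.symm (w 0)) (g.symm (w 1)) (g.symm (w 2))
    simp only [LinearEquiv.apply_symm_apply] at this
    rw [this]
  · rintro ⟨B, c, hc, rfl⟩
    have hB : E.map (E.equiv B (Equiv.refl _)) = B := by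
      ext i; simp
    set g := E.equiv B (Equiv.refl _)
    have key : ∀ w : Fin 3 → V, assocForm (M B) (fun i => g (w i)) = assocForm (M E) w := by
      intro w
      rw [apply_eq_tri, apply_eq_tri, ← hM E g, hB]
    refine ⟨⟨c, hc, g, fun w => ?_⟩, c⁻¹, inv_ne_zero hc, g.symm, fun w => ?_⟩
    · simp [assocForm_smul, key]
    · have := key fun i => g.symm (w i)
      simp only [LinearEquiv.apply_symm_apply] at this
      simp [assocForm_smul, this, hc]

/-! ### Two-dimensional subspaces and dimension counts -/

theorem finrank_span_pair {x y : V} (h : LinearIndependent K ![x, y]) :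
    Module.finrank K (Submodule.span K {x, y}) = 2 := by
  have := finrank_span_eq_card h
  rwa [Matrix.range_cons_cons_empty] at this

theorem eq_span_pair [FiniteDimensional K V] {X : Submodule K V} (hX : Module.finrank K X = 2)
    {x y : V} (hx : x ∈ X) (hy : y ∈ X) (h : LinearIndependent K ![x, y]) :
    X = Submodule.span K {x, y} := by
  refine (Submodule.eq_of_le_of_finrank_eq ?_ ?_).symm
  · rw [Submodule.span_le]
    rintro z (rfl | rfl)
    exacts [hx, hy]
  · rw [finrank_span_pair h, hX]

theorem exists_eq_span_pair [FiniteDimensional K V] {X : Submodule K V}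
    (hX : Module.finrank K X = 2) :
    ∃ x y : V, LinearIndependent K ![x, y] ∧ X = Submodule.span K {x, y} := by
  have b := Module.finBasisOfFinrankEq K X hX
  have h : LinearIndependent K ![(b 0 : V), (b 1 : V)] := by
    have := b.linearIndependent.map' X.subtype X.ker_subtype
    have e : X.subtype ∘ b = ![(b 0 : V), (b 1 : V)] := by
      funext i; fin_cases i <;> rfl
    rwa [e] at this
  exact ⟨b 0, b 1, h, eq_span_pair hX (b 0).2 (b 1).2 h⟩

theorem exists_linearIndependent_pair [FiniteDimensional K V] {X : Submodule K V}
    (hX : Module.finrank K X = 2) {x : V} (hx : x ∈ X) (hx0 : x ≠ 0) :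
    ∃ y ∈ X, LinearIndependent K ![x, y] := by
  obtain ⟨y, hy⟩ := exists_linearIndependent_pair_of_one_lt_finrank (R := K) (M := X)
    (by omega) (x := ⟨x, hx⟩) (by simpa [Subtype.ext_iff] using hx0)
  refine ⟨y, y.2, ?_⟩
  have := hy.map' X.subtype X.ker_subtype
  have e : X.subtype ∘ ![⟨x, hx⟩, y] = ![x, (y : V)] := by
    funext i; fin_cases i <;> rfl
  rwa [e] at this

theorem linearIndependent_pair_iff_notMem_span {x y : V} (hx : x ≠ 0) :
    LinearIndependent K ![x, y] ↔ ∀ c : K, y ≠ c • x := by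
  rw [LinearIndependent.pair_iff' hx]
  exact forall_congr' fun c => ne_comm

theorem exists_overspace [FiniteDimensional K V] {n : ℕ} (hn : n ≤ Module.finrank K V)
    (W : Submodule K V) (hW : Module.finrank K W ≤ n) :
    ∃ Y : Submodule K V, W ≤ Y ∧ Module.finrank K Y = n := by
  obtain ⟨d, hd⟩ := Nat.exists_eq_add_of_le hW
  induction d generalizing W with
  | zero => exact ⟨W, le_rfl, by omega⟩
  | succ d ih =>
    obtain ⟨v, hv⟩ : ∃ v, v ∉ W := by
      by_contra! hall
      rw [(Submodule.eq_top_iff' (p := W)).2 hall, finrank_top] at hd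
      omega
    have h1 := Submodule.finrank_sup_span_singleton hv
    obtain ⟨Y, hY, hY'⟩ := ih (W ⊔ Submodule.span K {v}) (by omega) (by omega)
    exact ⟨Y, le_sup_left.trans hY, hY'⟩

theorem finrank_sup_span_singleton_le [FiniteDimensional K V] (W : Submodule K V) (v : V) :
    Module.finrank K ↥(W ⊔ Submodule.span K {v}) ≤ Module.finrank K W + 1 :=
  (Submodule.finrank_add_le_finrank_add_finrank _ _).trans
    (by
      have := finrank_span_le_card (R := K) ({v} : Set V)
      simp only [Set.toFinset_singleton, Finset.card_singleton] at this
      omega)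

/-! ### Radicals of the hyperplane of a trilinear form -/

theorem mem_formHyperplane_iff (φ : V [⋀^Fin 3]→ₗ[K] K) (X : Submodule K V) :
    X ∈ formHyperplane φ ↔
      Module.finrank K X = 3 ∧ ∀ x ∈ X, ∀ y ∈ X, ∀ z ∈ X, tri φ x y z = 0 := by
  refine and_congr_right fun _ => ⟨fun h x hx y hy z hz => ?_, fun h w hw => ?_⟩
  · refine h ![x, y, z] fun i => ?_
    fin_cases i <;> assumption
  · rw [apply_eq_tri]
    exact h _ (hw 0) _ (hw 1) _ (hw 2)

theorem mem_formRadical_iff (φ : V [⋀^Fin 3]→ₗ[K] K) (v : V) :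
    v ∈ formRadical φ ↔ tri φ v = 0 := by
  constructor
  · intro h
    ext y z
    have : φ.curryLeft v = 0 := h
    have := DFunLike.congr_fun this ![y, z]
    simpa [tri_apply] using this
  · intro h
    change φ.curryLeft v = 0
    ext w
    have : tri φ v (w 0) (w 1) = 0 := by rw [h]; rfl
    rw [tri_apply] at this
    rw [AlternatingMap.curryLeft_apply_apply, AlternatingMap.zero_apply, ← this]
    congr 1
    funext i; fin_cases i <;> rfl

section Overspaces

variable [FiniteDimensional K V]

/-- A `2`-subspace is in the upper radical when each pair of its vectors is annihilated by the
form: any third vector lies in some common `3`-dimensional overspace. -/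
theorem mem_upperRadical_iff (h3 : 3 ≤ Module.finrank K V) (φ : V [⋀^Fin 3]→ₗ[K] K)
    (X : Submodule K V) :
    X ∈ upperRadical (formHyperplane φ) ↔
      Module.finrank K X = 2 ∧ ∀ x ∈ X, ∀ y ∈ X, tri φ x y = 0 := by
  have ht := isAlt₃_tri φ
  refine and_congr_right fun hX => ⟨fun h x hx y hy => ?_, fun h Y hY hXY => ?_⟩
  · ext z
    obtain ⟨Y, hY, hY'⟩ := exists_overspace h3 (X ⊔ Submodule.span K {z})
      ((finrank_sup_span_singleton_le X z).trans (by omega))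
    have hXY : X ≤ Y := le_sup_left.trans hY
    exact ((mem_formHyperplane_iff φ Y).1 (h Y hY' hXY)).2 x (hXY hx) y (hXY hy) z
      (hY (le_sup_right (a := X) (Submodule.mem_span_singleton_self z)))
  · rw [mem_formHyperplane_iff]
    refine ⟨hY, ?_⟩
    obtain ⟨z, hzY, hz⟩ : ∃ z ∈ Y, z ∉ X := by
      by_contra! hall
      have := Submodule.finrank_mono hall
      omega
    have hYeq : X ⊔ Submodule.span K {z} = Y := by
      refine Submodule.eq_of_le_of_finrank_eq (sup_le hXY ?_) ?_
      · rwa [Submodule.span_singleton_le_iff_mem]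
      · rw [Submodule.finrank_sup_span_singleton hz, hX, hY]
    have hmem : ∀ y ∈ Y, ∃ x ∈ X, ∃ c : K, y = x + c • z := by
      intro y hy
      rw [← hYeq, Submodule.mem_sup] at hy
      obtain ⟨x, hx, w, hw, rfl⟩ := hy
      obtain ⟨c, rfl⟩ := Submodule.mem_span_singleton.1 hw
      exact ⟨x, hx, c, rfl⟩
    intro a ha b hb c hc
    obtain ⟨a, hax, r, rfl⟩ := hmem a ha
    obtain ⟨b, hbx, s, rfl⟩ := hmem b hb
    obtain ⟨c, hcx, u, rfl⟩ := hmem c hc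
    have e1 : tri φ a b = 0 := h a hax b hbx
    have e2 : tri φ z b c = 0 := by rw [ht.rotate, h b hbx c hcx]; rfl
    have e3 : tri φ a z c = 0 := by rw [ht.swap₂₃, h a hax c hcx]; simp
    simp [e1, e2, e3, ht.left, ht.right, ht.outer]

theorem span_pair_mem_upperRadical_iff (h3 : 3 ≤ Module.finrank K V) (φ : V [⋀^Fin 3]→ₗ[K] K)
    {x y : V} (hxy : LinearIndependent K ![x, y]) :
    Submodule.span K {x, y} ∈ upperRadical (formHyperplane φ) ↔ tri φ x y = 0 := by
  have ht := isAlt₃_tri φ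
  rw [mem_upperRadical_iff h3]
  refine ⟨fun h => h.2 x (Submodule.subset_span (by simp)) y (Submodule.subset_span (by simp)),
    fun h => ⟨finrank_span_pair hxy, fun a ha b hb => ?_⟩⟩
  obtain ⟨r, s, rfl⟩ := Submodule.mem_span_pair.1 ha
  obtain ⟨r', s', rfl⟩ := Submodule.mem_span_pair.1 hb
  ext z
  have h1 : tri φ y x z = 0 := by rw [ht.swap₁₂, h]; simp
  simp [h, h1, ht.left]

theorem mem_lowerRadical_iff (h3 : 3 ≤ Module.finrank K V) (φ : V [⋀^Fin 3]→ₗ[K] K)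
    (X : Submodule K V) :
    X ∈ lowerRadical (formHyperplane φ) ↔ Module.finrank K X = 1 ∧ X ≤ formRadical φ := by
  have ht := isAlt₃_tri φ
  refine and_congr_right fun hX => ⟨fun h x hx => ?_, fun h Y hY hXY => ?_⟩
  · rw [mem_formRadical_iff]
    ext y z
    obtain ⟨Y, hY, hY'⟩ :=
      exists_overspace h3 ((X ⊔ Submodule.span K {y}) ⊔ Submodule.span K {z})
        ((finrank_sup_span_singleton_le _ z).trans
          (by have := finrank_sup_span_singleton_le X y; omega))
    rw [sup_le_iff, sup_le_iff, Submodule.span_singleton_le_iff_mem,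
      Submodule.span_singleton_le_iff_mem] at hY
    obtain ⟨⟨hXY, hy⟩, hz⟩ := hY
    exact ((mem_formHyperplane_iff φ Y).1 (h Y hY' hXY)).2 x (hXY hx) y hy z hz
  · -- `Y` contains the span of a vector of `X` and another one, which is in the upper radical.
    obtain ⟨v, hv, hv0⟩ := X.exists_mem_ne_zero_of_ne_bot (by rintro rfl; simp at hX)
    obtain ⟨w, hwY, hw⟩ : ∃ w ∈ Y, w ∉ X := by
      by_contra! hall
      have := Submodule.finrank_mono hall
      omega
    have hvw : LinearIndependent K ![v, w] := by
      rw [linearIndependent_pair_iff_notMem_span hv0]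
      rintro c rfl
      exact hw (X.smul_mem c hv)
    refine ((span_pair_mem_upperRadical_iff h3 φ hvw).2 ?_).2 Y hY ?_
    · rw [(mem_formRadical_iff φ v).1 (h hv)]; rfl
    · rw [Submodule.span_le]
      rintro u (rfl | rfl)
      exacts [hXY hv, hwY]

end Overspaces

/-! ### Invariance under scaling, and trivial extensions -/

theorem formHyperplane_smul {c : K} (hc : c ≠ 0) (φ : V [⋀^Fin 3]→ₗ[K] K) :
    formHyperplane (c • φ) = formHyperplane φ := by
  ext X
  simp [formHyperplane, hc]

theorem formRadical_smul {c : K} (hc : c ≠ 0) (φ : V [⋀^Fin 3]→ₗ[K] K) :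
    formRadical (c • φ) = formRadical φ := by
  ext v
  simp [mem_formRadical_iff, tri_smul, hc]

theorem formRank_smul {c : K} (hc : c ≠ 0) (φ : V [⋀^Fin 3]→ₗ[K] K) :
    formRank (c • φ) = formRank φ := by
  rw [formRank, formRank, formRadical_smul hc]

theorem mem_subspaceHyperplane_iff {k : ℕ} (W : Submodule K V) (φ : W [⋀^Fin k]→ₗ[K] K)
    (X : Submodule K V) :
    X ∈ subspaceHyperplane W φ ↔
      X ≤ W ∧ Module.finrank K X = k ∧ ∀ w : Fin k → W, (∀ i, (w i : V) ∈ X) → φ w = 0 := by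
  constructor
  · rintro ⟨Y, ⟨hY, hw⟩, rfl⟩
    refine ⟨Submodule.map_subtype_le W Y, ?_, fun w h => hw w fun i => ?_⟩
    · rw [← hY]
      exact Submodule.finrank_map_subtype_eq W Y
    · simpa using h i
  · rintro ⟨hX, hk, h⟩
    have e : Submodule.map W.subtype (Submodule.comap W.subtype X) = X := by
      rw [Submodule.map_comap_subtype, inf_eq_right.2 hX]
    refine ⟨Submodule.comap W.subtype X, ⟨?_, fun w hw => h w fun i => hw i⟩, e⟩
    rw [← hk]
    exact (Submodule.comapSubtypeEquivOfLe hX).finrank_eq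

/-- A form is the trivial extension of its restriction to any complement of its radical. -/
theorem isTrivialExtension_formRadical {φ : V [⋀^Fin 3]→ₗ[K] K} (hφ : φ ≠ 0)
    (hrad : formRadical φ ≠ ⊥) {V₀ : Submodule K V} (hc : IsCompl V₀ (formRadical φ)) :
    IsTrivialExtension 3 (formHyperplane φ) V₀ (formRadical φ)
      (subspaceHyperplane V₀ (φ.compLinearMap V₀.subtype)) := by
  have ht := isAlt₃_tri φ
  have key : (φ.compLinearMap V₀.subtype).compLinearMap
      (V₀.projectionOnto (formRadical φ) hc) = φ := by
    have hd : ∀ v : V, ∃ r ∈ formRadical φ, v = V₀.projectionOnto (formRadical φ) hc v + r := by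
      intro v
      refine ⟨v - V₀.projectionOnto (formRadical φ) hc v, ?_, by abel⟩
      rw [← Submodule.projectionOnto_apply_eq_zero_iff hc, map_sub,
        Submodule.projectionOnto_apply_left, sub_self]
    ext w
    obtain ⟨r₀, h₀, e₀⟩ := hd (w 0)
    obtain ⟨r₁, h₁, e₁⟩ := hd (w 1)
    obtain ⟨r₂, h₂, e₂⟩ := hd (w 2)
    rw [mem_formRadical_iff] at h₀ h₁ h₂
    rw [apply_eq_tri φ, e₀, e₁, e₂]
    have a₁ : ∀ x y, tri φ x r₁ y = 0 := fun x y => by rw [ht.swap₁₂, h₁]; simp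
    have a₂ : ∀ x y, tri φ x y r₂ = 0 := fun x y => by rw [ht.swap₁₃, h₂]; simp
    simp only [map_add, LinearMap.add_apply, h₀, a₁, a₂]
    simp [AlternatingMap.compLinearMap_apply, apply_eq_tri φ]
  refine ⟨hrad, hc, φ.compLinearMap V₀.subtype, ?_, rfl, by rw [key]⟩
  intro h0
  apply hφ
  rw [← key, h0]
  ext; simp

/-! ### Cubics in two triples of coordinates -/

/-- The first three and the last three coordinates with respect to a basis of six vectors. -/
noncomputable def split (B : Module.Basis (Fin 6) K V) : V ≃ₗ[K] (Fin 3 → K) × (Fin 3 → K) :=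
  B.equivFun ≪≫ₗ LinearEquiv.funCongrLeft K K finSumFinEquiv ≪≫ₗ
    LinearEquiv.sumArrowLequivProdArrow (Fin 3) (Fin 3) K K

theorem split_fst (B : Module.Basis (Fin 6) K V) (x : V) :
    (split B x).1 = ![B.repr x 0, B.repr x 1, B.repr x 2] := by
  funext i; fin_cases i <;> rfl

theorem split_snd (B : Module.Basis (Fin 6) K V) (x : V) :
    (split B x).2 = ![B.repr x 3, B.repr x 4, B.repr x 5] := by
  funext i; fin_cases i <;> rfl

/-- The form `a₀ [x y z] + a₁ ([x y z'] + [x y' z] + [x' y z]) + a₂ ([x y' z'] + ⋯) +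
a₃ [x' y' z']`, where `x` and `x'` are the two triples of coordinates of a vector and `[x y z]`
is the triple product; the coefficients of the coordinates of the third argument are collected. -/
def IsCubic (B : Module.Basis (Fin 6) K V) (a₀ a₁ a₂ a₃ : K) (φ : V [⋀^Fin 3]→ₗ[K] K) : Prop :=
  ∀ x y z, tri φ x y z =
    (a₀ • (split B x).1 ⨯₃ (split B y).1 +
      a₁ • ((split B x).1 ⨯₃ (split B y).2 + (split B x).2 ⨯₃ (split B y).1) +
      a₂ • (split B x).2 ⨯₃ (split B y).2) ⬝ᵥ (split B z).1 +
    (a₁ • (split B x).1 ⨯₃ (split B y).1 +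
      a₂ • ((split B x).1 ⨯₃ (split B y).2 + (split B x).2 ⨯₃ (split B y).1) +
      a₃ • (split B x).2 ⨯₃ (split B y).2) ⬝ᵥ (split B z).2

theorem isCubic_modelT1 (B : Module.Basis (Fin 6) K V) :
    IsCubic B 1 0 0 0 (assocForm (modelT1 B)) := by
  intro x y z
  simp only [modelT1, tri_wedge, split_fst, split_snd, cross_apply]
  simp [dotProduct, Fin.sum_univ_three]
  ring

theorem isCubic_modelT3 (B : Module.Basis (Fin 6) K V) :
    IsCubic B 1 0 0 1 (assocForm (modelT3 B)) := by
  intro x y z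
  simp only [modelT3, assocForm_add, tri_add, LinearMap.add_apply, tri_wedge, split_fst,
    split_snd, cross_apply]
  simp [dotProduct, Fin.sum_univ_three]
  ring

theorem isCubic_modelT4 (B : Module.Basis (Fin 6) K V) :
    IsCubic B 0 (-1) 0 0 (assocForm (modelT4 B)) := by
  intro x y z
  simp only [modelT4, assocForm_add, tri_add, LinearMap.add_apply, tri_wedge, split_fst,
    split_snd, cross_apply]
  simp [dotProduct, Fin.sum_univ_three]
  ring

theorem isCubic_modelT10₁ (B : Module.Basis (Fin 6) K V) (c : K) :
    IsCubic B 1 0 c 0 (assocForm (modelT10₁ B c)) := by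
  intro x y z
  simp only [modelT10₁, assocForm_add, assocForm_smul, tri_smul, tri_add, LinearMap.add_apply,
    LinearMap.smul_apply, tri_wedge, split_fst, split_snd, cross_apply]
  simp [dotProduct, Fin.sum_univ_three]
  ring

theorem isCubic_modelT10₂ (B : Module.Basis (Fin 6) K V) (c : K) :
    IsCubic B 0 1 c (c ^ 2 + 1) (assocForm (modelT10₂ B c)) := by
  intro x y z
  simp only [modelT10₂, assocForm_add, assocForm_smul, tri_smul, tri_add, LinearMap.add_apply,
    LinearMap.smul_apply, tri_wedge, split_fst, split_snd, cross_apply]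
  simp [dotProduct, Fin.sum_univ_three]
  ring

theorem eq_zero_of_forall_cross {F : Type*} [Field F] {a : Fin 3 → F} (h : ∀ b, a ⨯₃ b = 0) :
    a = 0 := by
  have h1 := h ![1, 0, 0]
  have h2 := h ![0, 1, 0]
  simp only [cross_apply] at h1 h2
  funext i
  have e1 := congrFun h1 1
  have e2 := congrFun h1 2
  have e3 := congrFun h2 2
  fin_cases i <;> simp at e1 e2 e3 ⊢ <;> assumption

theorem cross_eq_zero_iff_exists {F : Type*} [Field F] {a b : Fin 3 → F} (ha : a ≠ 0) :
    a ⨯₃ b = 0 ↔ ∃ c : F, b = c • a := by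
  rw [← not_iff_not, ← ne_eq, crossProduct_ne_zero_iff_linearIndependent,
    LinearIndependent.pair_iff' ha]
  simp [eq_comm]

/-- Two vectors whose images in a three-dimensional space have zero cross product span a vector
of the kernel. -/
theorem exists_combination_mem_ker (p : V →ₗ[K] (Fin 3 → K)) {x y : V}
    (hxy : LinearIndependent K ![x, y]) (h : p x ⨯₃ p y = 0) :
    ∃ b ∈ Submodule.span K {x, y}, b ≠ 0 ∧ p b = 0 := by
  have := mt crossProduct_ne_zero_iff_linearIndependent.2 (not_not.2 h)
  rw [LinearIndependent.pair_iff] at this hxy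
  push Not at this
  obtain ⟨s, t, hst, hne⟩ := this
  refine ⟨s • x + t • y, Submodule.mem_span_pair.2 ⟨s, t, rfl⟩, fun h0 => ?_, by simpa using hst⟩
  exact hne (hxy s t h0).1 (hxy s t h0).2

namespace IsCubic

variable {B : Module.Basis (Fin 6) K V} {a₀ a₁ a₂ a₃ : K} {φ : V [⋀^Fin 3]→ₗ[K] K}
  (hφ : IsCubic B a₀ a₁ a₂ a₃ φ)
include hφ

theorem tri_eq_zero_iff (x y : V) :
    tri φ x y = 0 ↔
      (a₀ • (split B x).1 ⨯₃ (split B y).1 +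
        a₁ • ((split B x).1 ⨯₃ (split B y).2 + (split B x).2 ⨯₃ (split B y).1) +
        a₂ • (split B x).2 ⨯₃ (split B y).2 = 0) ∧
      (a₁ • (split B x).1 ⨯₃ (split B y).1 +
        a₂ • ((split B x).1 ⨯₃ (split B y).2 + (split B x).2 ⨯₃ (split B y).1) +
        a₃ • (split B x).2 ⨯₃ (split B y).2 = 0) := by
  constructor
  · intro h
    constructor
    · refine dotProduct_eq_zero_iff.1 fun w => ?_
      have := hφ x y ((split B).symm (w, 0))
      rw [h] at this
      simpa using this.symm
    · refine dotProduct_eq_zero_iff.1 fun w => ?_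
      have := hφ x y ((split B).symm (0, w))
      rw [h] at this
      simpa using this.symm
  · rintro ⟨h1, h2⟩
    ext z
    rw [hφ, h1, h2]
    simp

theorem mem_formRadical_iff (x : V) :
    x ∈ formRadical φ ↔
      a₀ • (split B x).1 + a₁ • (split B x).2 = 0 ∧
      a₁ • (split B x).1 + a₂ • (split B x).2 = 0 ∧
      a₂ • (split B x).1 + a₃ • (split B x).2 = 0 := by
  rw [AltForm.mem_formRadical_iff]
  constructor
  · intro h
    have h' : ∀ y, tri φ x y = 0 := fun y => by rw [h]; rfl
    have key1 := fun b : Fin 3 → K => (hφ.tri_eq_zero_iff _ _).1 (h' ((split B).symm (b, 0)))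
    have key2 := fun b : Fin 3 → K => (hφ.tri_eq_zero_iff _ _).1 (h' ((split B).symm (0, b)))
    simp only [LinearEquiv.apply_symm_apply, map_zero, add_zero, zero_add, smul_zero] at key1 key2
    refine ⟨eq_zero_of_forall_cross fun b => ?_, eq_zero_of_forall_cross fun b => ?_,
      eq_zero_of_forall_cross fun b => ?_⟩
    · simpa using (key1 b).1
    · simpa using (key1 b).2
    · simpa using (key2 b).2
  · rintro ⟨h1, h2, h3⟩
    ext y z
    have hz : tri φ x y = 0 := by
      rw [hφ.tri_eq_zero_iff]
      constructor
      · have e1 := congrArg (· ⨯₃ (split B y).1) h1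
        have e2 := congrArg (· ⨯₃ (split B y).2) h2
        simp only [map_add, map_smul, LinearMap.add_apply, LinearMap.smul_apply, map_zero,
          LinearMap.zero_apply] at e1 e2
        rw [← add_zero (0 : Fin 3 → K)]
        nth_rw 1 [← e1]
        rw [← e2]
        module
      · have e1 := congrArg (· ⨯₃ (split B y).1) h2
        have e2 := congrArg (· ⨯₃ (split B y).2) h3
        simp only [map_add, map_smul, LinearMap.add_apply, LinearMap.smul_apply, map_zero,
          LinearMap.zero_apply] at e1 e2
        rw [← add_zero (0 : Fin 3 → K)]
        nth_rw 1 [← e1]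
        rw [← e2]
        module
    rw [hz]; rfl

end IsCubic

theorem finrank_eq_six (B : Module.Basis (Fin 6) K V) : Module.finrank K V = 6 := by
  simpa using Module.finrank_eq_card_basis B

theorem three_le_finrank (B : Module.Basis (Fin 6) K V) : 3 ≤ Module.finrank K V := by
  rw [finrank_eq_six B]; norm_num

theorem formRank_eq_six (B : Module.Basis (Fin 6) K V) {φ : V [⋀^Fin 3]→ₗ[K] K}
    (h : formRadical φ = ⊥) : formRank φ = 6 := by
  rw [formRank, h, (Submodule.quotEquivOfEqBot ⊥ rfl).finrank_eq, finrank_eq_six B]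

/-- The projection to the first three coordinates. -/
noncomputable def head (B : Module.Basis (Fin 6) K V) : V →ₗ[K] (Fin 3 → K) :=
  LinearMap.fst K _ _ ∘ₗ (split B).toLinearMap

/-- The projection to the last three coordinates. -/
noncomputable def tail (B : Module.Basis (Fin 6) K V) : V →ₗ[K] (Fin 3 → K) :=
  LinearMap.snd K _ _ ∘ₗ (split B).toLinearMap

theorem head_apply (B : Module.Basis (Fin 6) K V) (x : V) : head B x = (split B x).1 := rfl

theorem tail_apply (B : Module.Basis (Fin 6) K V) (x : V) : tail B x = (split B x).2 := rfl

theorem head_surjective (B : Module.Basis (Fin 6) K V) : Function.Surjective (head B) :=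
  fun a => ⟨(split B).symm (a, 0), by simp [head_apply]⟩

theorem tail_surjective (B : Module.Basis (Fin 6) K V) : Function.Surjective (tail B) :=
  fun a => ⟨(split B).symm (0, a), by simp [tail_apply]⟩

theorem eq_zero_of_head_tail (B : Module.Basis (Fin 6) K V) {x : V} (h : head B x = 0)
    (h' : tail B x = 0) : x = 0 :=
  (split B).map_eq_zero_iff.1 (Prod.ext h h')

theorem isCompl_ker_tail_ker_head (B : Module.Basis (Fin 6) K V) :
    IsCompl (LinearMap.ker (tail B)) (LinearMap.ker (head B)) := by
  constructor
  · rw [Submodule.disjoint_def]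
    exact fun x h h' => eq_zero_of_head_tail B h' h
  · rw [codisjoint_iff, Submodule.eq_top_iff']
    intro x
    refine Submodule.mem_sup.2 ⟨(split B).symm (head B x, 0), ?_, (split B).symm (0, tail B x),
      ?_, ?_⟩
    · simp [tail_apply]
    · simp [head_apply]
    · rw [← map_add, LinearEquiv.symm_apply_eq]
      simp [head_apply, tail_apply]

theorem finrank_ker_of_surjective (B : Module.Basis (Fin 6) K V) {p : V →ₗ[K] (Fin 3 → K)}
    (hp : Function.Surjective p) : Module.finrank K (LinearMap.ker p) = 3 := by
  have : FiniteDimensional K V := Module.Finite.of_basis B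
  have := p.finrank_range_add_finrank_ker
  rw [LinearMap.range_eq_top.2 hp, finrank_top, finrank_eq_six B] at this
  simp at this
  omega

/-! ### The types `T₁`, `T₃` and `T₄` -/

section Split

variable (B : Module.Basis (Fin 6) K V)

theorem formRadical_modelT1 :
    formRadical (assocForm (modelT1 B)) = LinearMap.ker (head B) := by
  ext x
  rw [(isCubic_modelT1 B).mem_formRadical_iff, LinearMap.mem_ker, head_apply]
  simp

theorem formRank_modelT1 : formRank (assocForm (modelT1 B)) = 3 := by
  rw [formRank, formRadical_modelT1,
    ((head B).quotKerEquivOfSurjective (head_surjective B)).finrank_eq]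
  simp

theorem modelT1_ne_zero : assocForm (modelT1 B) ≠ 0 := by
  intro h
  have := formRank_modelT1 B
  rw [h, formRank] at this
  have h0 : formRadical (0 : V [⋀^Fin 3]→ₗ[K] K) = ⊤ := by
    rw [Submodule.eq_top_iff']
    intro x
    rw [mem_formRadical_iff, (tri_eq_zero_iff _).2 rfl]; rfl
  rw [h0] at this
  have := Module.finrank_zero_of_subsingleton (R := K) (M := V ⧸ (⊤ : Submodule K V))
  omega

theorem isTrivialHyperplane_modelT1 :
    IsTrivialHyperplane 3 (formHyperplane (assocForm (modelT1 B)))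
      (formRadical (assocForm (modelT1 B))) := by
  have hc : IsCompl (LinearMap.ker (tail B)) (formRadical (assocForm (modelT1 B))) := by
    rw [formRadical_modelT1]
    exact isCompl_ker_tail_ker_head B
  have h3 := finrank_ker_of_surjective B (tail_surjective B)
  refine ⟨LinearMap.ker (tail B), h3, ?_⟩
  have hbot : formRadical (assocForm (modelT1 B)) ≠ ⊥ := by
    intro h
    have := finrank_ker_of_surjective B (head_surjective B)
    rw [← formRadical_modelT1, h] at this
    simp at this
  have key := isTrivialExtension_formRadical (modelT1_ne_zero B) hbot hc
  convert key
  -- A member of the restricted hyperplane would be the whole complement of the radical.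
  symm
  rw [Set.eq_empty_iff_forall_notMem]
  intro X hX
  obtain ⟨-, -, φ₀, hφ₀, he, -⟩ := key
  have : FiniteDimensional K V := Module.Finite.of_basis B
  rw [he, mem_subspaceHyperplane_iff] at hX
  have hXe : X = LinearMap.ker (tail B) :=
    Submodule.eq_of_le_of_finrank_eq hX.1 (by rw [hX.2.1, h3])
  apply hφ₀
  ext w
  exact hX.2.2 w fun i => by rw [hXe]; exact (w i).2

theorem upperRadical_modelT1 :
    upperRadical (formHyperplane (assocForm (modelT1 B))) =
      {X : Submodule K V | Module.finrank K X = 2 ∧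
        X ⊓ formRadical (assocForm (modelT1 B)) ≠ ⊥} := by
  have : FiniteDimensional K V := Module.Finite.of_basis B
  have ht := isAlt₃_tri (assocForm (modelT1 B))
  ext X
  constructor
  · intro hX
    have h2 : Module.finrank K X = 2 := hX.1
    obtain ⟨x, y, hxy, rfl⟩ := exists_eq_span_pair h2
    refine ⟨h2, ?_⟩
    rw [span_pair_mem_upperRadical_iff (three_le_finrank B) _ hxy,
      (isCubic_modelT1 B).tri_eq_zero_iff] at hX
    obtain ⟨b, hb, hb0, hpb⟩ := exists_combination_mem_ker (head B) hxy
      (by simpa [head_apply] using hX.1)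
    rw [Submodule.ne_bot_iff, formRadical_modelT1]
    exact ⟨b, ⟨hb, hpb⟩, hb0⟩
  · rintro ⟨h2, hne⟩
    obtain ⟨b, ⟨hbX, hbr⟩, hb0⟩ := (Submodule.ne_bot_iff _).1 hne
    obtain ⟨y, hy, hby⟩ := exists_linearIndependent_pair h2 hbX hb0
    rw [eq_span_pair h2 hbX hy hby, span_pair_mem_upperRadical_iff (three_le_finrank B) _ hby,
      (mem_formRadical_iff _ b).1 hbr]
    rfl

theorem formRadical_modelT3 : formRadical (assocForm (modelT3 B)) = ⊥ := by
  rw [Submodule.eq_bot_iff]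
  intro x hx
  rw [(isCubic_modelT3 B).mem_formRadical_iff] at hx
  exact eq_zero_of_head_tail B (by simpa [head_apply] using hx.1)
    (by simpa [tail_apply] using hx.2.2)

theorem upperRadical_modelT3 :
    upperRadical (formHyperplane (assocForm (modelT3 B))) =
      {X : Submodule K V | ∃ x ∈ LinearMap.ker (tail B), ∃ y ∈ LinearMap.ker (head B),
        x ≠ 0 ∧ y ≠ 0 ∧ X = Submodule.span K {x, y}} := by
  have : FiniteDimensional K V := Module.Finite.of_basis B
  have hind : ∀ x ∈ LinearMap.ker (tail B), ∀ y ∈ LinearMap.ker (head B), x ≠ 0 → y ≠ 0 →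
      LinearIndependent K ![x, y] := by
    intro x hx y hy hx0 hy0
    rw [linearIndependent_pair_iff_notMem_span hx0]
    rintro c rfl
    exact hy0 (Submodule.disjoint_def.1 (isCompl_ker_tail_ker_head B).disjoint _
      (Submodule.smul_mem _ c hx) hy)
  ext X
  constructor
  · intro hX
    have h2 : Module.finrank K X = 2 := hX.1
    obtain ⟨x, y, hxy, rfl⟩ := exists_eq_span_pair h2
    rw [span_pair_mem_upperRadical_iff (three_le_finrank B) _ hxy,
      (isCubic_modelT3 B).tri_eq_zero_iff] at hX
    obtain ⟨b, hb, hb0, hpb⟩ := exists_combination_mem_ker (head B) hxy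
      (by simpa [head_apply] using hX.1)
    obtain ⟨a, ha, ha0, hpa⟩ := exists_combination_mem_ker (tail B) hxy
      (by simpa [tail_apply] using hX.2)
    exact ⟨a, hpa, b, hpb, ha0, hb0, eq_span_pair h2 ha hb (hind a hpa b hpb ha0 hb0)⟩
  · rintro ⟨x, hx, y, hy, hx0, hy0, rfl⟩
    rw [span_pair_mem_upperRadical_iff (three_le_finrank B) _ (hind x hx y hy hx0 hy0),
      (isCubic_modelT3 B).tri_eq_zero_iff]
    rw [LinearMap.mem_ker, tail_apply] at hx
    rw [LinearMap.mem_ker, head_apply] at hy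
    simp [hx, hy]

theorem formRadical_modelT4 : formRadical (assocForm (modelT4 B)) = ⊥ := by
  rw [Submodule.eq_bot_iff]
  intro x hx
  rw [(isCubic_modelT4 B).mem_formRadical_iff] at hx
  exact eq_zero_of_head_tail B (by simpa [head_apply] using hx.2.1)
    (by simpa [tail_apply] using hx.1)

/-- The exchange of the first and the last three coordinates. -/
noncomputable def exchange : V ≃ₗ[K] V :=
  split B ≪≫ₗ LinearEquiv.prodComm K _ _ ≪≫ₗ (split B).symm

theorem head_exchange (x : V) : head B (exchange B x) = tail B x := by
  simp [exchange, head_apply, tail_apply]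

theorem tail_exchange (x : V) : tail B (exchange B x) = head B x := by
  simp [exchange, head_apply, tail_apply]

/-- The isomorphism from the span of the first three basis vectors to the span of the last
three. -/
noncomputable def shift : LinearMap.ker (tail B) ≃ₗ[K] LinearMap.ker (head B) :=
  (exchange B).ofSubmodules _ _ (by
    ext x
    rw [Submodule.mem_map_equiv, LinearMap.mem_ker, LinearMap.mem_ker, ← head_exchange,
      LinearEquiv.apply_symm_apply])

theorem tail_shift (x : LinearMap.ker (tail B)) : tail B (shift B x) = head B x := by
  rw [← tail_exchange]; rfl

theorem upperRadical_modelT4 :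
    upperRadical (formHyperplane (assocForm (modelT4 B))) =
      {X : Submodule K V | ∃ (x : LinearMap.ker (tail B)) (y : LinearMap.ker (head B)), x ≠ 0 ∧
        X = Submodule.span K {(x : V) + (y : V), (shift B x : V)}} ∪
      {X : Submodule K V | Module.finrank K X = 2 ∧ X ≤ LinearMap.ker (head B)} := by
  have : FiniteDimensional K V := Module.Finite.of_basis B
  have hhead : ∀ x : LinearMap.ker (tail B), x ≠ 0 → head B x ≠ 0 := fun x hx h =>
    hx (Subtype.ext (eq_zero_of_head_tail B h x.2))
  have hind : ∀ (x : LinearMap.ker (tail B)) (y : LinearMap.ker (head B)), x ≠ 0 →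
      LinearIndependent K ![(x : V) + (y : V), (shift B x : V)] := by
    intro x y hx
    have h0 : head B ((x : V) + y) ≠ 0 := by
      rw [map_add, y.2, add_zero]
      exact hhead x hx
    rw [linearIndependent_pair_iff_notMem_span (fun h => h0 (by rw [h, map_zero]))]
    intro c hc
    have h1 := congrArg (head B) hc
    rw [(shift B x).2, map_smul] at h1
    rcases smul_eq_zero.1 h1.symm with rfl | h
    · rw [zero_smul] at hc
      have := tail_shift B x
      rw [hc, map_zero] at this
      exact hhead x hx this.symm
    · exact h0 h
  ext X
  constructor
  · intro hX
    have h2 : Module.finrank K X = 2 := hX.1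
    obtain ⟨b, hbX, hb0, hpb⟩ : ∃ b ∈ X, b ≠ 0 ∧ head B b = 0 := by
      obtain ⟨x, y, hxy, rfl⟩ := exists_eq_span_pair h2
      rw [span_pair_mem_upperRadical_iff (three_le_finrank B) _ hxy,
        (isCubic_modelT4 B).tri_eq_zero_iff] at hX
      exact exists_combination_mem_ker (head B) hxy (by
        rw [← neg_eq_zero, cross_anticomm]; simpa [head_apply] using hX.2)
    obtain ⟨z, hzX, hbz⟩ := exists_linearIndependent_pair h2 hbX hb0
    by_cases hz : head B z = 0
    · right
      refine ⟨h2, ?_⟩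
      rw [eq_span_pair h2 hbX hzX hbz, Submodule.span_le]
      rintro u (rfl | rfl)
      exacts [hpb, hz]
    · left
      have hzb := ((mem_upperRadical_iff (three_le_finrank B) _ X).1 hX).2 z hzX b hbX
      rw [(isCubic_modelT4 B).tri_eq_zero_iff] at hzb
      rw [head_apply] at hpb hz
      have hcross : (split B z).1 ⨯₃ (split B b).2 = 0 := by
        rw [← neg_eq_zero, cross_anticomm]; simpa [hpb] using hzb.1
      -- The last coordinates of `b` are proportional to the first coordinates of `z`.
      obtain ⟨c, hc⟩ := (cross_eq_zero_iff_exists hz).1 hcross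
      have hc0 : c ≠ 0 := by
        rintro rfl
        exact hb0 (eq_zero_of_head_tail B hpb (by rw [tail_apply, hc, zero_smul]))
      let x : LinearMap.ker (tail B) :=
        ⟨(split B).symm ((split B z).1, 0), by simp [tail_apply]⟩
      let y : LinearMap.ker (head B) :=
        ⟨(split B).symm (0, (split B z).2), by simp [head_apply]⟩
      have hx : x ≠ 0 := by
        intro h
        have := congrArg (fun w : LinearMap.ker (tail B) => head B w) h
        simp only [x, head_apply, LinearEquiv.apply_symm_apply, Submodule.coe_zero, map_zero]
          at this
        exact hz this
      have hxy : (x : V) + y = z := by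
        simp only [x, y]
        rw [← map_add, LinearEquiv.symm_apply_eq]
        simp
      have hxb : (shift B x : V) = c⁻¹ • b := by
        refine sub_eq_zero.1 (eq_zero_of_head_tail B ?_ ?_)
        · rw [map_sub, (shift B x).2, map_smul, head_apply, hpb]; simp
        · rw [map_sub, tail_shift, map_smul, tail_apply B b, hc, smul_smul, inv_mul_cancel₀ hc0]
          simp [x, head_apply]
      refine ⟨x, y, hx, eq_span_pair h2 ?_ ?_ (hind x y hx)⟩
      · rwa [hxy]
      · rw [hxb]; exact X.smul_mem _ hbX
  · rintro (⟨x, y, hx, rfl⟩ | ⟨h2, hX⟩)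
    · rw [span_pair_mem_upperRadical_iff (three_le_finrank B) _ (hind x y hx),
        (isCubic_modelT4 B).tri_eq_zero_iff]
      have e1 : head B (shift B x) = 0 := (shift B x).2
      have e2 : head B y = 0 := y.2
      have e3 := tail_shift B x
      rw [head_apply] at e1 e2 e3
      rw [tail_apply] at e3
      simp [e1, e2, e3]
    · rw [mem_upperRadical_iff (three_le_finrank B)]
      refine ⟨h2, fun x hx y hy => ?_⟩
      rw [(isCubic_modelT4 B).tri_eq_zero_iff]
      have e1 : head B x = 0 := hX hx
      have e2 : head B y = 0 := hX hy
      rw [head_apply] at e1 e2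
      simp [e1, e2]

end Split

/-! ### The types `T₁₀` -/

section Spread

variable {L : Type u} [Field L] [Algebra K L] (b : Module.Basis (Fin 2) K L)

/-- Pairs of triples over `K` as triples over a quadratic extension, by means of a basis of the
extension. -/
noncomputable def pairEquiv : ((Fin 3 → K) × (Fin 3 → K)) ≃ₗ[K] (Fin 3 → L) where
  toFun p i := p.1 i • b 0 + p.2 i • b 1
  invFun l := (fun i => b.repr (l i) 0, fun i => b.repr (l i) 1)
  map_add' p q := by
    funext i
    simp only [Prod.fst_add, Prod.snd_add, Pi.add_apply]
    module
  map_smul' c p := by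
    funext i
    simp [smul_smul]
  left_inv p := by
    ext i <;> simp
  right_inv l := by
    funext i
    have := b.sum_repr (l i)
    rwa [Fin.sum_univ_two] at this

/-- The identification of `V` with `L³` given by a basis of six vectors of `V` and a `K`-basis
of the quadratic extension `L`. -/
noncomputable def cubeEquiv (B : Module.Basis (Fin 6) K V) : V ≃ₗ[K] (Fin 3 → L) :=
  split B ≪≫ₗ pairEquiv b

variable {b} {B : Module.Basis (Fin 6) K V} {φ : V [⋀^Fin 3]→ₗ[K] K} {ℓ : L →ₗ[K] K}

/-- A cubic whose coefficients are the values of a linear functional of `L` at the powers of a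
generator is the composition of this functional with the determinant on `L³`. -/
theorem IsCubic.tri_eq_functional_det (h0 : b 0 = 1)
    (hφ : IsCubic B (ℓ 1) (ℓ (b 1)) (ℓ (b 1 ^ 2)) (ℓ (b 1 ^ 3)) φ) (x y z : V) :
    tri φ x y z = ℓ ((cubeEquiv b B x ⨯₃ cubeEquiv b B y) ⬝ᵥ cubeEquiv b B z) := by
  have he : ∀ x, cubeEquiv b B x = fun i =>
      algebraMap K L ((split B x).1 i) + algebraMap K L ((split B x).2 i) * b 1 := by
    intro x
    funext i
    simp [cubeEquiv, pairEquiv, h0, Algebra.smul_def]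
  rw [hφ, he, he, he]
  obtain ⟨x, x'⟩ := split B x
  obtain ⟨y, y'⟩ := split B y
  obtain ⟨z, z'⟩ := split B z
  set μ := b 1
  have key : ∀ r₀ r₁ r₂ r₃ : K,
      ℓ (algebraMap K L r₀ + algebraMap K L r₁ * μ + algebraMap K L r₂ * μ ^ 2 +
        algebraMap K L r₃ * μ ^ 3) = r₀ * ℓ 1 + r₁ * ℓ μ + r₂ * ℓ (μ ^ 2) + r₃ * ℓ (μ ^ 3) := by
    intro r₀ r₁ r₂ r₃
    have : algebraMap K L r₀ = r₀ • (1 : L) := by rw [Algebra.smul_def, mul_one]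
    rw [this]
    simp only [← Algebra.smul_def, map_add, map_smul, smul_eq_mul]
  have e := key ((x ⨯₃ y) ⬝ᵥ z) ((x ⨯₃ y) ⬝ᵥ z' + (x ⨯₃ y') ⬝ᵥ z + (x' ⨯₃ y) ⬝ᵥ z)
    ((x ⨯₃ y') ⬝ᵥ z' + (x' ⨯₃ y) ⬝ᵥ z' + (x' ⨯₃ y') ⬝ᵥ z) ((x' ⨯₃ y') ⬝ᵥ z')
  simp only [add_dotProduct, smul_dotProduct, smul_eq_mul]
  trans
  swap
  · refine e.symm.trans (congrArg ℓ ?_)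
    simp only [cross_apply, dotProduct, Fin.sum_univ_three, Matrix.cons_val_zero,
      Matrix.cons_val_one, Matrix.cons_val, map_add, map_sub, map_mul]
    ring
  · ring

variable (hℓ : ℓ ≠ 0)
  (hdet : ∀ x y z, tri φ x y z =
    ℓ ((cubeEquiv b B x ⨯₃ cubeEquiv b B y) ⬝ᵥ cubeEquiv b B z))
include hℓ hdet

/-- Since a nonzero functional `ℓ` of `L` vanishes on no nonzero ideal, the contraction by `x` and
`y` is zero only if they are proportional over `L`. -/
theorem tri_eq_zero_iff_cross (x y : V) :
    tri φ x y = 0 ↔ cubeEquiv b B x ⨯₃ cubeEquiv b B y = 0 := by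
  constructor
  · intro h
    obtain ⟨u, hu⟩ : ∃ u, ℓ u ≠ 0 := by
      by_contra! hall
      exact hℓ (LinearMap.ext hall)
    by_contra hne
    obtain ⟨i, hi⟩ := Function.ne_iff.1 hne
    set a := cubeEquiv b B x ⨯₃ cubeEquiv b B y
    apply hu
    have := hdet x y ((cubeEquiv b B).symm (Pi.single i ((a i)⁻¹ * u)))
    rw [h, LinearEquiv.apply_symm_apply, dotProduct_single, mul_inv_cancel_left₀ hi] at this
    exact this.symm
  · intro h
    ext z
    rw [hdet, h]
    simp

theorem formRadical_eq_bot_of_det : formRadical φ = ⊥ := by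
  rw [Submodule.eq_bot_iff]
  intro x hx
  rw [mem_formRadical_iff] at hx
  rw [← (cubeEquiv b B).map_eq_zero_iff]
  refine eq_zero_of_forall_cross fun a => ?_
  have := (tri_eq_zero_iff_cross hℓ hdet x ((cubeEquiv b B).symm a)).1 (by rw [hx]; rfl)
  rwa [LinearEquiv.apply_symm_apply] at this

/-- For a form that is a functional of the determinant on `L³`, the upper radical is the set of
the `L`-lines. -/
theorem isDesarguesianLineSpread_of_det :
    IsDesarguesianLineSpread (upperRadical (formHyperplane φ)) := by
  have : FiniteDimensional K V := Module.Finite.of_basis B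
  let e := cubeEquiv b B
  let _ : Module L V := e.toAddEquiv.module L
  have hsmul : ∀ (l : L) (x : V), e (l • x) = l • e x := fun l x => e.apply_symm_apply _
  have : IsScalarTower K L V := ⟨fun k l x => e.injective (by
    rw [hsmul, map_smul, hsmul, smul_assoc])⟩
  have hL : Module.finrank K L = 2 := by simpa using Module.finrank_eq_card_basis b
  have hline : ∀ x : V, x ≠ 0 →
      Module.finrank K ((Submodule.span L {x}).restrictScalars K) = 2 := by
    intro x hx
    have h1 := Module.finrank_mul_finrank K L (Submodule.span L {x})
    rw [finrank_span_singleton hx, hL] at h1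
    exact h1.symm
  have hset : upperRadical (formHyperplane φ) =
      {X | ∃ x : V, x ≠ 0 ∧ X = (Submodule.span L {x}).restrictScalars K} := by
    ext X
    rw [mem_upperRadical_iff (three_le_finrank B)]
    constructor
    · rintro ⟨h2, hX⟩
      obtain ⟨x, hxX, hx⟩ := X.exists_mem_ne_zero_of_ne_bot (by rintro rfl; simp at h2)
      refine ⟨x, hx, Submodule.eq_of_le_of_finrank_eq (fun y hy => ?_) (by rw [h2, hline x hx])⟩
      have := (tri_eq_zero_iff_cross hℓ hdet x y).1 (hX x hxX y hy)
      rw [cross_eq_zero_iff_exists (by simpa using hx)] at this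
      obtain ⟨l, hl⟩ := this
      refine Submodule.mem_span_singleton.2 ⟨l, e.injective ?_⟩
      rw [hsmul]
      exact hl.symm
    · rintro ⟨x, hx, rfl⟩
      refine ⟨hline x hx, fun y hy z hz => ?_⟩
      obtain ⟨l, rfl⟩ := Submodule.mem_span_singleton.1 hy
      obtain ⟨m, rfl⟩ := Submodule.mem_span_singleton.1 hz
      rw [tri_eq_zero_iff_cross hℓ hdet]
      change e _ ⨯₃ e _ = 0
      rw [hsmul, hsmul]
      simp
  refine ⟨⟨fun X hX => hX.1, fun p hp => ?_⟩, L, inferInstance, inferInstance, inferInstance,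
    inferInstance, hL, hset⟩
  obtain ⟨x, hxp, hx⟩ := p.exists_mem_ne_zero_of_ne_bot (by rintro rfl; simp at hp)
  have hpx : p = Submodule.span K {x} := by
    refine (Submodule.eq_of_le_of_finrank_eq ?_ ?_).symm
    · rwa [Submodule.span_singleton_le_iff_mem]
    · rw [finrank_span_singleton hx, hp]
  subst hpx
  rw [hset]
  refine ⟨(Submodule.span L {x}).restrictScalars K, ⟨⟨x, hx, rfl⟩, ?_⟩, ?_⟩
  · rw [Submodule.span_singleton_le_iff_mem]
    exact Submodule.mem_span_singleton_self x
  · rintro X ⟨⟨y, hy, rfl⟩, hxy⟩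
    refine (Submodule.eq_of_le_of_finrank_eq ?_ (by rw [hline x hx, hline y hy])).symm
    rw [Submodule.span_singleton_le_iff_mem] at hxy
    rw [Submodule.restrictScalars_le]
    exact (Submodule.span_singleton_le_iff_mem _ _).2 hxy

end Spread

section T10

open Polynomial

variable (B : Module.Basis (Fin 6) K V)

/-- A quadratic extension given by an irreducible monic quadratic polynomial, with its basis
`1, μ`. -/
theorem exists_quadratic_extension {p q : K} (h : Irreducible (X ^ 2 + C p * X + C q : K[X])) :
    ∃ (L : Type u) (_ : Field L) (_ : Algebra K L) (b : Module.Basis (Fin 2) K L),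
      b 0 = 1 ∧ b 1 ^ 2 = -(p • b 1) - q • (1 : L) := by
  have : Fact (Irreducible (X ^ 2 + C p * X + C q : K[X])) := ⟨h⟩
  have hdeg : (X ^ 2 + C p * X + C q : K[X]).natDegree = 2 := by compute_degree!
  have hm : (X ^ 2 + C p * X + C q : K[X]).Monic := by monicity!
  let pb := AdjoinRoot.powerBasis' hm
  have hdim : pb.dim = 2 := hdeg
  have hb : ∀ i : Fin 2, (pb.basis.reindex (finCongr hdim)) i = pb.gen ^ (i : ℕ) := by
    intro i
    simp
  refine ⟨AdjoinRoot (X ^ 2 + C p * X + C q : K[X]), inferInstance, inferInstance,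
    pb.basis.reindex (finCongr hdim), by rw [hb]; simp, ?_⟩
  rw [hb]
  have hr := AdjoinRoot.eval₂_root (X ^ 2 + C p * X + C q : K[X])
  simp only [eval₂_add, eval₂_mul, eval₂_C, eval₂_X, eval₂_X_pow] at hr
  have hgen : pb.gen = AdjoinRoot.root _ := rfl
  rw [hgen, Algebra.smul_def, Algebra.smul_def, AdjoinRoot.algebraMap_eq]
  simp only [Fin.val_one, pow_one, mul_one]
  linear_combination hr

/-- The coefficients of the model are the coordinates along `1` of the powers of `μ`, where
`μ² = c`. -/
theorem modelT10₁_properties {c : K} (h : Irreducible (X ^ 2 - C c : K[X])) :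
    formRank (assocForm (modelT10₁ B c)) = 6 ∧
      IsDesarguesianLineSpread (upperRadical (formHyperplane (assocForm (modelT10₁ B c)))) := by
  have h' : Irreducible (X ^ 2 + C 0 * X + C (-c) : K[X]) := by
    simpa [sub_eq_add_neg] using h
  obtain ⟨L, _, _, b, h0, h1⟩ := exists_quadratic_extension h'
  have h2 : b 1 ^ 2 = c • b 0 := by rw [h1, h0]; simp
  have h3 : b 1 ^ 3 = c • b 1 := by rw [pow_succ, h2, h0]; simp
  have hdet := IsCubic.tri_eq_functional_det (b := b) (B := B) (ℓ := b.coord 0) h0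
    (by simpa [h2, h3, ← h0] using isCubic_modelT10₁ B c)
  have hℓ : b.coord 0 ≠ 0 := fun h => by simpa using LinearMap.congr_fun h (b 0)
  exact ⟨formRank_eq_six B (formRadical_eq_bot_of_det hℓ hdet),
    isDesarguesianLineSpread_of_det hℓ hdet⟩

/-- The coefficients of the model are the coordinates along `μ` of the powers of `μ`, where
`μ² = c μ + 1`. -/
theorem modelT10₂_properties [CharP K 2] {c : K} (h : Irreducible (X ^ 2 + C c * X + 1 : K[X])) :
    formRank (assocForm (modelT10₂ B c)) = 6 ∧
      IsDesarguesianLineSpread (upperRadical (formHyperplane (assocForm (modelT10₂ B c)))) := by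
  obtain ⟨L, _, _, b, h0, h1⟩ := exists_quadratic_extension (p := c) (q := 1) (by simpa using h)
  have h2 : b 1 ^ 2 = c • b 1 + b 0 := by
    rw [h1, h0, one_smul, ← neg_smul, CharTwo.neg_eq, sub_eq_add_neg]
    congr 1
    rw [← one_smul K (1 : L), ← neg_smul, CharTwo.neg_eq]
  have h3 : b 1 ^ 3 = (c ^ 2 + 1) • b 1 + c • b 0 := by
    rw [pow_succ, h2, add_mul, smul_mul_assoc, ← pow_two, h2, h0, one_mul]
    module
  have hdet := IsCubic.tri_eq_functional_det (b := b) (B := B) (ℓ := b.coord 1) h0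
    (by simpa [h2, h3, ← h0] using isCubic_modelT10₂ B c)
  have hℓ : b.coord 1 ≠ 0 := fun h => by simpa using LinearMap.congr_fun h (b 1)
  exact ⟨formRank_eq_six B (formRadical_eq_bot_of_det hℓ hdet),
    isDesarguesianLineSpread_of_det hℓ hdet⟩

end T10

/-! ### The type `T₂` -/

section T2

variable (B : Module.Basis (Fin 6) K V)

theorem tri_modelT2 (x y z : V) :
    tri (assocForm (modelT2 B)) x y z =
      B.repr x 0 * tri (assocForm (modelT2 B)) (B 0) y z -
      B.repr y 0 * tri (assocForm (modelT2 B)) (B 0) x z +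
      B.repr z 0 * tri (assocForm (modelT2 B)) (B 0) x y := by
  simp only [modelT2, assocForm_add, tri_add, LinearMap.add_apply, tri_wedge]
  simp
  ring

theorem tri_modelT2_zero (y z : V) :
    tri (assocForm (modelT2 B)) (B 0) y z =
      B.repr y 1 * B.repr z 2 - B.repr y 2 * B.repr z 1 +
      (B.repr y 3 * B.repr z 4 - B.repr y 4 * B.repr z 3) := by
  simp only [modelT2, assocForm_add, tri_add, LinearMap.add_apply, tri_wedge]
  simp

/-- The radical of the symplectic form on the middle four coordinates. -/
theorem repr_eq_zero_of_symplectic {x : V}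
    (h : ∀ y, B.repr y 0 = 0 → B.repr y 5 = 0 → tri (assocForm (modelT2 B)) (B 0) x y = 0) :
    B.repr x 1 = 0 ∧ B.repr x 2 = 0 ∧ B.repr x 3 = 0 ∧ B.repr x 4 = 0 := by
  have h1 := h (B 1) (by simp) (by simp)
  have h2 := h (B 2) (by simp) (by simp)
  have h3 := h (B 3) (by simp) (by simp)
  have h4 := h (B 4) (by simp) (by simp)
  rw [tri_modelT2_zero] at h1 h2 h3 h4
  simp at h1 h2 h3 h4
  exact ⟨h2, h1, h4, h3⟩

theorem eq_smul_of_repr {x : V} (h0 : B.repr x 0 = 0) (h : B.repr x 1 = 0 ∧ B.repr x 2 = 0 ∧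
    B.repr x 3 = 0 ∧ B.repr x 4 = 0) : x = B.repr x 5 • B 5 := by
  obtain ⟨h1, h2, h3, h4⟩ := h
  have := B.sum_repr x
  rw [Fin.sum_univ_six, h0, h1, h2, h3, h4] at this
  simpa using this.symm

theorem formRadical_modelT2 : formRadical (assocForm (modelT2 B)) = Submodule.span K {B 5} := by
  ext x
  rw [mem_formRadical_iff, Submodule.mem_span_singleton]
  constructor
  · intro h
    have ht : ∀ y z, tri (assocForm (modelT2 B)) x y z = 0 := fun y z => by rw [h]; rfl
    refine ⟨B.repr x 5, (eq_smul_of_repr B ?_ (repr_eq_zero_of_symplectic B fun y hy _ => ?_)).symm⟩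
    · have := ht (B 1) (B 2)
      rw [tri_modelT2, tri_modelT2_zero] at this
      simpa using this
    · rw [← neg_eq_zero, ← (isAlt₃_tri _).swap₁₂]
      exact ht _ _
  · rintro ⟨c, rfl⟩
    ext y z
    rw [tri_modelT2, tri_modelT2_zero, tri_modelT2_zero, tri_modelT2_zero]
    simp

theorem finrank_formRadical_modelT2 :
    Module.finrank K (formRadical (assocForm (modelT2 B))) = 1 := by
  rw [formRadical_modelT2, finrank_span_singleton (B.ne_zero 5)]

theorem formRank_modelT2 : formRank (assocForm (modelT2 B)) = 5 := by
  have : FiniteDimensional K V := Module.Finite.of_basis B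
  have := Submodule.finrank_quotient_add_finrank (formRadical (assocForm (modelT2 B)))
  rw [finrank_formRadical_modelT2, finrank_eq_six B] at this
  rw [formRank]
  omega

theorem lowerRadical_modelT2 :
    lowerRadical (formHyperplane (assocForm (modelT2 B))) =
      {formRadical (assocForm (modelT2 B))} := by
  have : FiniteDimensional K V := Module.Finite.of_basis B
  ext X
  rw [mem_lowerRadical_iff (three_le_finrank B), Set.mem_singleton_iff]
  constructor
  · rintro ⟨h1, hX⟩
    exact Submodule.eq_of_le_of_finrank_eq hX (by rw [h1, finrank_formRadical_modelT2])
  · rintro rfl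
    exact ⟨finrank_formRadical_modelT2 B, le_rfl⟩

/-- The complement `⟨e₁, …, e₅⟩` of the radical. -/
noncomputable def complT2 : Submodule K V := LinearMap.ker (B.coord 5)

/-- The four-dimensional space `⟨e₂, …, e₅⟩`. -/
noncomputable def coreT2 : Submodule K V := LinearMap.ker (B.coord 5) ⊓ LinearMap.ker (B.coord 0)

/-- The symplectic form `e² ∧ e³ + e⁴ ∧ e⁵` on `⟨e₂, …, e₅⟩`. -/
noncomputable def symplecticT2 : coreT2 B [⋀^Fin 2]→ₗ[K] K :=
  ((assocForm (modelT2 B)).curryLeft (B 0)).compLinearMap (coreT2 B).subtype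

theorem symplecticT2_apply (w : Fin 2 → coreT2 B) :
    symplecticT2 B w = tri (assocForm (modelT2 B)) (B 0) (w 0) (w 1) := by
  rw [symplecticT2, AlternatingMap.compLinearMap_apply, AlternatingMap.curryLeft_apply_apply,
    apply_eq_tri]
  rfl

theorem mem_coreT2 {x : V} : x ∈ coreT2 B ↔ B.repr x 5 = 0 ∧ B.repr x 0 = 0 := Iff.rfl

theorem isCompl_complT2 : IsCompl (complT2 B) (formRadical (assocForm (modelT2 B))) := by
  rw [formRadical_modelT2]
  constructor
  · rw [Submodule.disjoint_def]
    intro x hx h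
    obtain ⟨c, rfl⟩ := Submodule.mem_span_singleton.1 h
    have : B.repr (c • B 5) 5 = 0 := hx
    simp at this
    simp [this]
  · rw [codisjoint_iff, Submodule.eq_top_iff']
    intro x
    refine Submodule.mem_sup.2 ⟨x - B.repr x 5 • B 5, ?_, B.repr x 5 • B 5,
      Submodule.smul_mem _ _ (Submodule.mem_span_singleton_self _), by simp⟩
    simp [complT2]

theorem finrank_coreT2 : Module.finrank K (coreT2 B) = 4 := by
  have : FiniteDimensional K V := Module.Finite.of_basis B
  have e : coreT2 B = LinearMap.ker ((B.coord 5).prod (B.coord 0)) := (LinearMap.ker_prod _ _).symm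
  have hs : Function.Surjective ((B.coord 5).prod (B.coord 0)) := by
    rintro ⟨r, s⟩
    exact ⟨r • B 5 + s • B 0, by simp⟩
  have := ((B.coord 5).prod (B.coord 0)).finrank_range_add_finrank_ker
  rw [LinearMap.range_eq_top.2 hs, finrank_top, finrank_eq_six B, ← e] at this
  simp at this
  omega

theorem formRadical_symplecticT2 : formRadical (symplecticT2 B) = ⊥ := by
  rw [Submodule.eq_bot_iff]
  intro x hx
  have hx' : (symplecticT2 B).curryLeft x = 0 := hx
  have h := repr_eq_zero_of_symplectic B (x := (x : V)) fun y h0 h5 => by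
    have := DFunLike.congr_fun hx' ![⟨y, h5, h0⟩]
    rw [AlternatingMap.curryLeft_apply_apply, symplecticT2_apply] at this
    exact this
  have := eq_smul_of_repr B x.2.2 h
  rw [((mem_coreT2 B).1 x.2).1, zero_smul] at this
  exact Subtype.ext this

theorem mem_subspaceHyperplane_symplecticT2_iff (X : Submodule K V) :
    X ∈ subspaceHyperplane (coreT2 B) (symplecticT2 B) ↔
      X ≤ coreT2 B ∧ Module.finrank K X = 2 ∧
        ∀ x ∈ X, ∀ y ∈ X, tri (assocForm (modelT2 B)) (B 0) x y = 0 := by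
  rw [mem_subspaceHyperplane_iff]
  refine and_congr_right fun hX => and_congr_right fun _ => ⟨fun h x hx y hy => ?_,
    fun h w hw => ?_⟩
  · have := h ![⟨x, hX hx⟩, ⟨y, hX hy⟩] fun i => by fin_cases i <;> assumption
    rwa [symplecticT2_apply] at this
  · rw [symplecticT2_apply]
    exact h _ (hw 0) _ (hw 1)

theorem tri_modelT2_eq_zero_of_coreT2 {x y z : V} (hx : B.repr x 0 = 0) (hy : B.repr y 0 = 0)
    (hz : B.repr z 0 = 0) : tri (assocForm (modelT2 B)) x y z = 0 := by
  rw [tri_modelT2, hx, hy, hz]; ring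

theorem expansion_eq_subspaceHyperplane :
    expansion 3 (complT2 B) (coreT2 B) (subspaceHyperplane (coreT2 B) (symplecticT2 B)) =
      subspaceHyperplane (complT2 B)
        ((assocForm (modelT2 B)).compLinearMap (complT2 B).subtype) := by
  have : FiniteDimensional K V := Module.Finite.of_basis B
  have ht := isAlt₃_tri (assocForm (modelT2 B))
  ext X
  have hmem : X ∈ subspaceHyperplane (complT2 B)
      ((assocForm (modelT2 B)).compLinearMap (complT2 B).subtype) ↔
      X ≤ complT2 B ∧ Module.finrank K X = 3 ∧
        ∀ x ∈ X, ∀ y ∈ X, ∀ z ∈ X, tri (assocForm (modelT2 B)) x y z = 0 := by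
    rw [mem_subspaceHyperplane_iff]
    refine and_congr_right fun hX => and_congr_right fun _ =>
      ⟨fun h x hx y hy z hz => ?_, fun h w hw => ?_⟩
    · have := h ![⟨x, hX hx⟩, ⟨y, hX hy⟩, ⟨z, hX hz⟩] fun i => by fin_cases i <;> assumption
      rw [AlternatingMap.compLinearMap_apply, apply_eq_tri] at this
      exact this
    · rw [AlternatingMap.compLinearMap_apply, apply_eq_tri]
      exact h _ (hw 0) _ (hw 1) _ (hw 2)
  rw [hmem]
  refine and_congr_right fun hX => and_congr_right fun h3 => ?_
  by_cases hle : X ≤ coreT2 B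
  · refine iff_of_true (Or.inl hle) fun x hx y hy z hz => ?_
    exact tri_modelT2_eq_zero_of_coreT2 B (hle hx).2 (hle hy).2 (hle hz).2
  rw [or_iff_right hle, mem_subspaceHyperplane_symplecticT2_iff]
  -- `X` is spanned by `X ∩ V₀` and a vector `v` with first coordinate `1`.
  obtain ⟨v, hvX, hv⟩ : ∃ v ∈ X, B.repr v 0 = 1 := by
    obtain ⟨v, hvX, hv⟩ := SetLike.not_le_iff_exists.1 hle
    have hv0 : B.repr v 0 ≠ 0 := fun h => hv ⟨hX hvX, h⟩
    exact ⟨(B.repr v 0)⁻¹ • v, X.smul_mem _ hvX, by simp [hv0]⟩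
  have hdec : ∀ x ∈ X, x - B.repr x 0 • v ∈ X ⊓ coreT2 B := fun x hx => by
    have hm := X.sub_mem hx (X.smul_mem (B.repr x 0) hvX)
    exact ⟨hm, hX hm, by simp [hv]⟩
  have hv' : v ∉ X ⊓ coreT2 B := fun h => one_ne_zero (hv.symm.trans h.2.2)
  have hsup : X ⊓ coreT2 B ⊔ Submodule.span K {v} = X := by
    refine le_antisymm (sup_le inf_le_left ?_) fun x hx => ?_
    · rwa [Submodule.span_singleton_le_iff_mem]
    · exact Submodule.mem_sup.2 ⟨_, hdec x hx, B.repr x 0 • v,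
        Submodule.smul_mem _ _ (Submodule.mem_span_singleton_self v), by simp⟩
  have h2 : Module.finrank K ↥(X ⊓ coreT2 B) = 2 := by
    have := Submodule.finrank_sup_span_singleton hv'
    rw [hsup, h3] at this
    omega
  constructor
  · rintro ⟨-, -, h⟩ x hx y hy z hz
    have key : ∀ a ∈ X ⊓ coreT2 B, ∀ b ∈ X ⊓ coreT2 B,
        tri (assocForm (modelT2 B)) a b v = 0 := fun a ha b hb => by
      rw [tri_modelT2, ((mem_coreT2 B).1 ha.2).2, ((mem_coreT2 B).1 hb.2).2, h a ha b hb]; simp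
    rw [← sub_add_cancel x (B.repr x 0 • v), ← sub_add_cancel y (B.repr y 0 • v),
      ← sub_add_cancel z (B.repr z 0 • v)]
    have ha := hdec x hx
    have hb := hdec y hy
    have hc := hdec z hz
    generalize x - B.repr x 0 • v = a at ha ⊢
    generalize y - B.repr y 0 • v = b at hb ⊢
    generalize z - B.repr z 0 • v = c at hc ⊢
    have e1 := key a ha b hb
    have e2 : tri (assocForm (modelT2 B)) v b c = 0 := by rw [ht.rotate, key b hb c hc]
    have e3 : tri (assocForm (modelT2 B)) a v c = 0 := by rw [ht.swap₂₃, key a ha c hc, neg_zero]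
    have e4 := tri_modelT2_eq_zero_of_coreT2 B ha.2.2 hb.2.2 hc.2.2
    simp [e1, e2, e3, e4, ht.left, ht.right, ht.outer]
  · intro h
    refine ⟨inf_le_right, h2, fun x hx y hy => ?_⟩
    have := h v hvX x hx.1 y hy.1
    rw [tri_modelT2, hv, ((mem_coreT2 B).1 hx.2).2, ((mem_coreT2 B).1 hy.2).2] at this
    simpa using this

theorem isTrivialExtension_modelT2 :
    IsTrivialExtension 3 (formHyperplane (assocForm (modelT2 B))) (complT2 B)
      (formRadical (assocForm (modelT2 B)))
      (expansion 3 (complT2 B) (coreT2 B) (subspaceHyperplane (coreT2 B) (symplecticT2 B))) := by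
  rw [expansion_eq_subspaceHyperplane]
  refine isTrivialExtension_formRadical ?_ ?_ (isCompl_complT2 B)
  · intro h
    have h1 : tri (assocForm (modelT2 B)) (B 0) (B 1) (B 2) = 1 := by
      rw [tri_modelT2_zero]; simp
    rw [h, (tri_eq_zero_iff _).2 rfl] at h1
    exact zero_ne_one h1
  · intro h
    have := finrank_formRadical_modelT2 B
    rw [h] at this
    simp at this

theorem upperRadical_modelT2 :
    upperRadical (formHyperplane (assocForm (modelT2 B))) =
      {X : Submodule K V | Module.finrank K X = 2 ∧
        (formRadical (assocForm (modelT2 B)) ≤ X ∨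
          X.map ((complT2 B).projection (formRadical (assocForm (modelT2 B)))
            (isCompl_complT2 B)) ∈ subspaceHyperplane (coreT2 B) (symplecticT2 B))} := by
  have : FiniteDimensional K V := Module.Finite.of_basis B
  have ht := isAlt₃_tri (assocForm (modelT2 B))
  set π := (complT2 B).projection (formRadical (assocForm (modelT2 B))) (isCompl_complT2 B)
    with hπ
  -- The projection only changes the last coordinate.
  have hproj : ∀ x, ∃ c : K, x = π x + c • B 5 := by
    intro x
    have : x - π x ∈ formRadical (assocForm (modelT2 B)) := by
      rw [← Submodule.projectionOnto_apply_eq_zero_iff (isCompl_complT2 B), map_sub, hπ,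
        Submodule.projection_apply, Submodule.projectionOnto_apply_left, sub_self]
    rw [formRadical_modelT2] at this
    obtain ⟨c, hc⟩ := Submodule.mem_span_singleton.1 this
    exact ⟨c, by rw [hc]; abel⟩
  have hrepr : ∀ x, ∀ i ≠ 5, B.repr (π x) i = B.repr x i := by
    intro x i hi
    obtain ⟨c, hc⟩ := hproj x
    conv_rhs => rw [hc]
    simp [hi.symm]
  have hπ5 : ∀ x, π x ∈ complT2 B := fun x => by
    rw [hπ, Submodule.projection_apply]
    exact Subtype.coe_prop _
  have htri : ∀ x y, tri (assocForm (modelT2 B)) (B 0) (π x) (π y) =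
      tri (assocForm (modelT2 B)) (B 0) x y := by
    intro x y
    rw [tri_modelT2_zero, tri_modelT2_zero]
    simp only [hrepr _ _ (show (1 : Fin 6) ≠ 5 by decide),
      hrepr _ _ (show (2 : Fin 6) ≠ 5 by decide), hrepr _ _ (show (3 : Fin 6) ≠ 5 by decide),
      hrepr _ _ (show (4 : Fin 6) ≠ 5 by decide)]
  have h05 : (0 : Fin 6) ≠ 5 := by decide
  ext X
  rw [mem_upperRadical_iff (three_le_finrank B), Set.mem_ofPred_eq]
  refine and_congr_right fun h2 => ?_
  rw [mem_subspaceHyperplane_symplecticT2_iff]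
  constructor
  · intro h
    rw [or_iff_not_imp_left]
    intro hrad
    have hB5 : ∀ c : K, c • B 5 ∈ X → c = 0 := by
      intro c hc
      by_contra hc0
      apply hrad
      rw [formRadical_modelT2, Submodule.span_singleton_le_iff_mem]
      exact (X.smul_mem_iff hc0).1 hc
    have hker : ∀ x ∈ X, ∀ y ∈ X, B.repr x 0 • y = B.repr y 0 • x := by
      intro x hx y hy
      have hm : B.repr x 0 • y - B.repr y 0 • x ∈ X :=
        X.sub_mem (X.smul_mem _ hy) (X.smul_mem _ hx)
      have e0 : B.repr (B.repr x 0 • y - B.repr y 0 • x) 0 = 0 := by simp; ring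
      have := eq_smul_of_repr B e0 (repr_eq_zero_of_symplectic B fun z hz _ => by
        have := h x hx y hy
        have := LinearMap.congr_fun this z
        rw [tri_modelT2, hz] at this
        simpa using this)
      rw [this] at hm
      rw [hB5 _ hm, zero_smul] at this
      exact sub_eq_zero.1 this
    have h0 : ∀ x ∈ X, B.repr x 0 = 0 := by
      intro x hx
      by_contra hne
      have hx0 : x ≠ 0 := by rintro rfl; simp at hne
      obtain ⟨y, hy, hxy⟩ := exists_linearIndependent_pair h2 hx hx0
      rw [linearIndependent_pair_iff_notMem_span hx0] at hxy
      refine hxy ((B.repr x 0)⁻¹ * B.repr y 0) ?_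
      rw [mul_smul, ← hker x hx y hy, smul_smul, inv_mul_cancel₀ hne, one_smul]
    refine ⟨?_, ?_, ?_⟩
    · rintro _ ⟨x, hx, rfl⟩
      exact ⟨hπ5 x, (hrepr x 0 h05).trans (h0 x hx)⟩
    · rw [← h2]
      refine (LinearEquiv.finrank_eq (LinearEquiv.ofBijective
        (π.submoduleMap X) ⟨?_, π.submoduleMap_surjective X⟩)).symm
      rw [injective_iff_map_eq_zero]
      intro x hx
      have hx' : π x = 0 := congrArg Subtype.val hx
      obtain ⟨c, hc⟩ := hproj x
      rw [hx', zero_add] at hc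
      have := hB5 c (hc ▸ x.2)
      rw [this, zero_smul] at hc
      exact Subtype.ext hc
    · rintro _ ⟨x, hx, rfl⟩ _ ⟨y, hy, rfl⟩
      rw [htri, ht.rotate, h x hx y hy]
      rfl
  · rintro (hrad | ⟨hle, -, h⟩)
    · rw [formRadical_modelT2, Submodule.span_singleton_le_iff_mem] at hrad
      obtain ⟨y, hy, hli⟩ := exists_linearIndependent_pair h2 hrad (B.ne_zero 5)
      refine ((mem_upperRadical_iff (three_le_finrank B) _ X).1 ?_).2
      have h5 : B 5 ∈ formRadical (assocForm (modelT2 B)) := by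
        rw [formRadical_modelT2]; exact Submodule.mem_span_singleton_self _
      rw [eq_span_pair h2 hrad hy hli, span_pair_mem_upperRadical_iff (three_le_finrank B) _ hli,
        (mem_formRadical_iff _ _).1 h5]
      rfl
    · intro x hx y hy
      have hx0 : B.repr x 0 = 0 := (hrepr x 0 h05).symm.trans (hle ⟨x, hx, rfl⟩).2
      have hy0 : B.repr y 0 = 0 := (hrepr y 0 h05).symm.trans (hle ⟨y, hy, rfl⟩).2
      ext z
      rw [tri_modelT2, hx0, hy0, ← htri x y, h _ ⟨x, hx, rfl⟩ _ ⟨y, hy, rfl⟩]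
      simp

end T2

/-! ### Bases adapted to functionals, and recognition of the models -/

theorem finrank_ker_of_dual_family [FiniteDimensional K V] {k m : ℕ}
    (hkm : Module.finrank K V = k + m) (F : V →ₗ[K] (Fin k → K)) (b : Fin k → V)
    (hb : ∀ i, F (b i) = Pi.single i 1) : Module.finrank K (LinearMap.ker F) = m := by
  have hs : LinearMap.range F = ⊤ := by
    rw [LinearMap.range_eq_top]
    intro c
    refine ⟨∑ i, c i • b i, ?_⟩
    rw [map_sum]
    funext j
    simp [hb, Pi.single_apply]
  have h := F.finrank_range_add_finrank_ker
  rw [hs, finrank_top, hkm] at h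
  simpa using h

theorem exists_linearIndependent_ker [FiniteDimensional K V] {k m : ℕ}
    (hkm : Module.finrank K V = k + m) (F : V →ₗ[K] (Fin k → K)) (b : Fin k → V)
    (hb : ∀ i, F (b i) = Pi.single i 1) :
    ∃ u : Fin m → V, LinearIndependent K u ∧ ∀ j, F (u j) = 0 := by
  have u := Module.finBasisOfFinrankEq K (LinearMap.ker F) (finrank_ker_of_dual_family hkm F b hb)
  exact ⟨fun j => u j, u.linearIndependent.map' (LinearMap.ker F).subtype (Submodule.ker_subtype _),
    fun j => (u j).2⟩

theorem linearIndependent_append_ker {k m : ℕ} (F : V →ₗ[K] (Fin k → K)) {b : Fin k → V}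
    (hb : ∀ i, F (b i) = Pi.single i 1) {u : Fin m → V} (hu : LinearIndependent K u)
    (hFu : ∀ j, F (u j) = 0) : LinearIndependent K (Fin.append b u) := by
  have hF : ∀ c : Fin k → K, F (∑ i, c i • b i) = c := fun c => by
    rw [map_sum]
    funext j
    simp [hb, Pi.single_apply]
  have hb' : LinearIndependent K b := by
    rw [Fintype.linearIndependent_iff]
    intro c hc i
    rw [← hF c, hc]; simp
  have hd : Disjoint (Submodule.span K (Set.range b)) (Submodule.span K (Set.range u)) := by
    rw [Submodule.disjoint_def]
    intro x hx hx'
    obtain ⟨c, rfl⟩ := (Submodule.mem_span_range_iff_exists_fun K).1 hx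
    have hle : Submodule.span K (Set.range u) ≤ LinearMap.ker F := by
      rw [Submodule.span_le]
      rintro _ ⟨j, rfl⟩
      exact hFu j
    have h0 : F (∑ i, c i • b i) = 0 := hle hx'
    rw [hF] at h0
    simp [h0]
  have e : Sum.elim b u ∘ (finSumFinEquiv (m := k) (n := m)).symm = Fin.append b u := by
    funext i
    refine Fin.addCases (fun j => ?_) (fun j => ?_) i <;> simp
  rw [← e]
  exact (hb'.sum_type hu hd).comp _ (finSumFinEquiv (m := k) (n := m)).symm.injective

theorem exists_basis_of_linearIndependent (h6 : Module.finrank K V = 6) {w : Fin 6 → V}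
    (hw : LinearIndependent K w) : ∃ B : Module.Basis (Fin 6) K V, ∀ i, B i = w i :=
  ⟨basisOfLinearIndependentOfCardEqFinrank hw (by simp [h6]), fun i => by simp⟩

/-- An alternating trilinear form in dimension six is determined by twenty values. -/
theorem ext_twenty (B : Module.Basis (Fin 6) K V) {φ ψ : V [⋀^Fin 3]→ₗ[K] K}
    (h012 : tri φ (B 0) (B 1) (B 2) = tri ψ (B 0) (B 1) (B 2))
    (h013 : tri φ (B 0) (B 1) (B 3) = tri ψ (B 0) (B 1) (B 3))
    (h014 : tri φ (B 0) (B 1) (B 4) = tri ψ (B 0) (B 1) (B 4))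
    (h015 : tri φ (B 0) (B 1) (B 5) = tri ψ (B 0) (B 1) (B 5))
    (h023 : tri φ (B 0) (B 2) (B 3) = tri ψ (B 0) (B 2) (B 3))
    (h024 : tri φ (B 0) (B 2) (B 4) = tri ψ (B 0) (B 2) (B 4))
    (h025 : tri φ (B 0) (B 2) (B 5) = tri ψ (B 0) (B 2) (B 5))
    (h034 : tri φ (B 0) (B 3) (B 4) = tri ψ (B 0) (B 3) (B 4))
    (h035 : tri φ (B 0) (B 3) (B 5) = tri ψ (B 0) (B 3) (B 5))
    (h045 : tri φ (B 0) (B 4) (B 5) = tri ψ (B 0) (B 4) (B 5))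
    (h123 : tri φ (B 1) (B 2) (B 3) = tri ψ (B 1) (B 2) (B 3))
    (h124 : tri φ (B 1) (B 2) (B 4) = tri ψ (B 1) (B 2) (B 4))
    (h125 : tri φ (B 1) (B 2) (B 5) = tri ψ (B 1) (B 2) (B 5))
    (h134 : tri φ (B 1) (B 3) (B 4) = tri ψ (B 1) (B 3) (B 4))
    (h135 : tri φ (B 1) (B 3) (B 5) = tri ψ (B 1) (B 3) (B 5))
    (h145 : tri φ (B 1) (B 4) (B 5) = tri ψ (B 1) (B 4) (B 5))
    (h234 : tri φ (B 2) (B 3) (B 4) = tri ψ (B 2) (B 3) (B 4))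
    (h235 : tri φ (B 2) (B 3) (B 5) = tri ψ (B 2) (B 3) (B 5))
    (h245 : tri φ (B 2) (B 4) (B 5) = tri ψ (B 2) (B 4) (B 5))
    (h345 : tri φ (B 3) (B 4) (B 5) = tri ψ (B 3) (B 4) (B 5)) : φ = ψ := by
  refine ext_increasing B fun i j k hij hjk => ?_
  have hi : i = 0 ∨ i = 1 ∨ i = 2 ∨ i = 3 := by omega
  have hj : j = 1 ∨ j = 2 ∨ j = 3 ∨ j = 4 := by omega
  have hk : k = 2 ∨ k = 3 ∨ k = 4 ∨ k = 5 := by omega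
  rcases hi with rfl | rfl | rfl | rfl <;> rcases hj with rfl | rfl | rfl | rfl <;>
    first
    | exact absurd hij (by decide)
    | (rcases hk with rfl | rfl | rfl | rfl <;>
        first
        | exact absurd hjk (by decide)
        | assumption)

/-! ### Forms with a vector of rank two -/

/-- The contraction `t v` has rank two, being the exterior product of the functionals
`t v · q` and `t v p ·`. -/
structure IsRankTwo (t : V →ₗ[K] V →ₗ[K] V →ₗ[K] K) (v p q : V) : Prop where
  one : t v p q = 1
  rank : ∀ x y, t v x y = t v x q * t v p y - t v y q * t v p x

/-- Three independent vectors that span the complement of `⟨v, p, q⟩` annihilated by the dual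
functionals `t · p q`, `t v · q` and `t v p ·`. -/
structure IsFrame (t : V →ₗ[K] V →ₗ[K] V →ₗ[K] K) (v p q : V) (u : Fin 3 → V) : Prop
    extends IsRankTwo t v p q where
  upq : ∀ i, t (u i) p q = 0
  vuq : ∀ i, t v (u i) q = 0
  vpu : ∀ i, t v p (u i) = 0
  li : LinearIndependent K u

theorem IsRankTwo.exists_isFrame {t : V →ₗ[K] V →ₗ[K] V →ₗ[K] K} (ht : IsAlt₃ t)
    (h6 : Module.finrank K V = 6) {v p q : V} (h : IsRankTwo t v p q) :
    ∃ u, IsFrame t v p q u := by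
  have : FiniteDimensional K V := Module.finite_of_finrank_pos (by omega)
  let F : V →ₗ[K] (Fin 3 → K) := LinearMap.pi ![(t.flip p).flip q, (t v).flip q, t v p]
  have hF : ∀ x, F x = ![t x p q, t v x q, t v p x] := fun x => by
    funext i; fin_cases i <;> rfl
  obtain ⟨u, hu, hFu⟩ := exists_linearIndependent_ker (m := 3) h6 F ![v, p, q] (fun i => by
    rw [hF]; funext j; fin_cases i <;> fin_cases j <;> simp [h.one, ht.left, ht.right, ht.outer])
  simp only [hF] at hFu
  exact ⟨u, h, fun i => congrFun (hFu i) 0, fun i => congrFun (hFu i) 1,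
    fun i => congrFun (hFu i) 2, hu⟩

namespace IsFrame

variable {t : V →ₗ[K] V →ₗ[K] V →ₗ[K] K} {v p q : V} {u : Fin 3 → V}

theorem vu (h : IsFrame t v p q u) (i : Fin 3) : t v (u i) = 0 := by
  ext y
  rw [h.rank, h.vuq, h.vpu]; simp

theorem linearIndependent (ht : IsAlt₃ t) (h : IsFrame t v p q u) :
    LinearIndependent K ![v, p, q, u 0, u 1, u 2] := by
  let F : V →ₗ[K] (Fin 3 → K) := LinearMap.pi ![(t.flip p).flip q, (t v).flip q, t v p]
  have hF : ∀ x, F x = ![t x p q, t v x q, t v p x] := fun x => by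
    funext i; fin_cases i <;> rfl
  have := linearIndependent_append_ker F (b := ![v, p, q]) (fun i => by
    rw [hF]; funext j
    fin_cases i <;> fin_cases j <;> simp [h.one, ht.left, ht.right, ht.outer]) h.li (fun i => by
    rw [hF]; funext j; fin_cases j <;> simp [h.upq, h.vuq, h.vpu])
  have e : Fin.append ![v, p, q] u = ![v, p, q, u 0, u 1, u 2] := by
    funext i; fin_cases i <;> rfl
  rwa [e] at this

/-- The vectors of a frame may be replaced by any basis of their span. -/
theorem change (h : IsFrame t v p q u) {w : Fin 3 → V} (hw : LinearIndependent K w)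
    (hwu : ∀ i, ∃ c : Fin 3 → K, w i = ∑ j, c j • u j) : IsFrame t v p q w := by
  refine ⟨h.toIsRankTwo, fun i => ?_, fun i => ?_, fun i => ?_, hw⟩ <;>
  · obtain ⟨c, hc⟩ := hwu i
    simp [hc, Fin.sum_univ_three, h.upq, h.vuq, h.vpu]

/-- The rotation of a frame in the plane `⟨p, q⟩`. -/
theorem rotate (ht : IsAlt₃ t) (h : IsFrame t v p q u) : IsFrame t v q (-p) u := by
  refine ⟨⟨?_, fun x y => ?_⟩, fun i => ?_, fun i => ?_, fun i => ?_, h.li⟩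
  · rw [map_neg, ← ht.swap₂₃, h.one]
  · rw [map_neg, map_neg, ← ht.swap₂₃, ← ht.swap₂₃, ht.swap₂₃ v q, ht.swap₂₃ v q, h.rank]
    ring
  · rw [map_neg, ← ht.swap₂₃, h.upq]
  · rw [map_neg, ← ht.swap₂₃, h.vpu]
  · rw [ht.swap₂₃, h.vuq, neg_zero]

/-- The shear of a frame in the plane `⟨p, q⟩`. -/
theorem shear (ht : IsAlt₃ t) (h : IsFrame t v p q u) (k : K) : IsFrame t v p (q - k • p) u := by
  refine ⟨⟨?_, fun x y => ?_⟩, fun i => ?_, fun i => ?_, fun i => ?_, h.li⟩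
  · simp [h.one, ht.right]
  · simp only [map_sub, map_smul, smul_eq_mul, ht.swap₂₃ v x p, ht.swap₂₃ v y p]
    rw [h.rank]
    ring
  · simp [h.upq, ht.right]
  · simp [h.vuq, ht.swap₂₃ v _ p, h.vpu]
  · exact h.vpu i

variable {φ : V [⋀^Fin 3]→ₗ[K] K}

theorem hasModelT1 (h6 : Module.finrank K V = 6) (h : IsFrame (tri φ) v p q u)
    (hp : ∀ i j, tri φ p (u i) (u j) = 0) (hq : ∀ i j, tri φ q (u i) (u j) = 0)
    (hu : tri φ (u 0) (u 1) (u 2) = 0) :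
    ∃ B : Module.Basis (Fin 6) K V, φ = assocForm (modelT1 B) := by
  have ht := isAlt₃_tri φ
  obtain ⟨B, hB⟩ := exists_basis_of_linearIndependent h6 (h.linearIndependent ht)
  have hpq : ∀ i, tri φ p q (u i) = 0 := fun i => by rw [← ht.rotate, h.upq]
  refine ⟨B, ?_⟩
  apply ext_twenty B <;>
  · simp only [modelT1, tri_wedge, Module.Basis.repr_self]
    simp [hB, h.one, h.vpu, h.vu, hpq, hp, hq, hu, ht.swap₂₃ v q]

theorem hasModelT3 (h6 : Module.finrank K V = 6) (h : IsFrame (tri φ) v p q u)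
    (hp : ∀ i j, tri φ p (u i) (u j) = 0) (hq : ∀ i j, tri φ q (u i) (u j) = 0)
    (hu : tri φ (u 0) (u 1) (u 2) = 1) :
    ∃ B : Module.Basis (Fin 6) K V, φ = assocForm (modelT3 B) := by
  have ht := isAlt₃_tri φ
  obtain ⟨B, hB⟩ := exists_basis_of_linearIndependent h6 (h.linearIndependent ht)
  have hpq : ∀ i, tri φ p q (u i) = 0 := fun i => by rw [← ht.rotate, h.upq]
  refine ⟨B, ?_⟩
  apply ext_twenty B <;>
  · simp only [modelT3, assocForm_add, tri_add, LinearMap.add_apply, tri_wedge,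
      Module.Basis.repr_self]
    simp [hB, h.one, h.vpu, h.vu, hpq, hp, hq, hu, ht.swap₂₃ v q]

theorem hasModelT2 (h6 : Module.finrank K V = 6) (h : IsFrame (tri φ) v p q u)
    (h01 : tri φ p (u 0) (u 1) = 1) (h02 : tri φ p (u 0) (u 2) = 0)
    (h12 : tri φ p (u 1) (u 2) = 0) (hq : ∀ i j, tri φ q (u i) (u j) = 0)
    (hu : tri φ (u 0) (u 1) (u 2) = 0) :
    ∃ B : Module.Basis (Fin 6) K V, φ = assocForm (modelT2 B) := by
  have ht := isAlt₃_tri φ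
  have hli := (h.linearIndependent ht).comp ![1, 2, 0, 3, 4, 5] (by decide)
  obtain ⟨B, hB⟩ := exists_basis_of_linearIndependent h6 hli
  have hpq : ∀ i, tri φ p q (u i) = 0 := fun i => by rw [← ht.rotate, h.upq]
  have hpqv : tri φ p q v = 1 := by rw [← ht.rotate, h.one]
  have hpv : ∀ i, tri φ p v (u i) = 0 := fun i => by rw [ht.swap₁₂, h.vpu, neg_zero]
  have hqv : ∀ i, tri φ q v (u i) = 0 := fun i => by rw [ht.rotate, h.vu]; rfl
  refine ⟨B, ?_⟩
  apply ext_twenty B <;>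
  · simp only [modelT2, assocForm_add, tri_add, LinearMap.add_apply, tri_wedge,
      Module.Basis.repr_self]
    simp [hB, hpqv, hpv, hqv, h.vu, hpq, h01, h02, h12, hq, hu]

theorem hasModelT4 (h6 : Module.finrank K V = 6) (h : IsFrame (tri φ) v p q u)
    (hp01 : tri φ p (u 0) (u 1) = -1) (hp02 : tri φ p (u 0) (u 2) = 0)
    (hp12 : tri φ p (u 1) (u 2) = 0) (hq01 : tri φ q (u 0) (u 1) = 0)
    (hq02 : tri φ q (u 0) (u 2) = 1) (hq12 : tri φ q (u 1) (u 2) = 0)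
    (hu : tri φ (u 0) (u 1) (u 2) = 0) :
    ∃ B : Module.Basis (Fin 6) K V, φ = assocForm (modelT4 B) := by
  have ht := isAlt₃_tri φ
  have hli := (h.linearIndependent ht).comp ![2, 1, 3, 4, 5, 0] (by decide)
  obtain ⟨B, hB⟩ := exists_basis_of_linearIndependent h6 hli
  have hqp : ∀ i, tri φ q p (u i) = 0 := fun i => by rw [ht.swap₁₃, h.upq, neg_zero]
  have hqpv : tri φ q p v = -1 := by rw [ht.swap₁₃, h.one]
  have hpv : ∀ i, tri φ p (u i) v = 0 := fun i => by rw [← ht.rotate, h.vpu]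
  have hqv : ∀ i, tri φ q (u i) v = 0 := fun i => by rw [ht.swap₁₃, h.vuq, neg_zero]
  have huv : ∀ i j, tri φ (u i) (u j) v = 0 := fun i j => by rw [← ht.rotate, h.vu]; rfl
  refine ⟨B, ?_⟩
  apply ext_twenty B <;>
  · simp only [modelT4, assocForm_add, tri_add, LinearMap.add_apply, tri_wedge,
      Module.Basis.repr_self]
    simp [hB, hqp, hqpv, hpv, hqv, huv, hp01, hp02, hp12, hq01, hq02, hq12, hu]

end IsFrame

theorem linearIndependent_of_tri_ne_zero {φ : V [⋀^Fin 3]→ₗ[K] K} {u : Fin 3 → V}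
    (h : tri φ (u 0) (u 1) (u 2) ≠ 0) : LinearIndependent K u := by
  by_contra hli
  exact h (by rw [← apply_eq_tri]; exact φ.map_linearDependent u hli)

/-- In dimension three the bilinear form `t p` is the scalar product of a fixed vector with the
cross product; this vector spans the radical if `t p` is not zero. -/
theorem IsAlt₃.apply_combination {t : V →ₗ[K] V →ₗ[K] V →ₗ[K] K} (ht : IsAlt₃ t) (p : V)
    (u : Fin 3 → V) (x y : Fin 3 → K) :
    t p (∑ j, x j • u j) (∑ j, y j • u j) =
      ![t p (u 1) (u 2), t p (u 2) (u 0), t p (u 0) (u 1)] ⬝ᵥ (x ⨯₃ y) := by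
  simp only [Fin.sum_univ_three, map_add, map_smul, LinearMap.add_apply, LinearMap.smul_apply,
    smul_eq_mul, ht.right, dotProduct, cross_apply, ht.swap₂₃ p (u 1) (u 0),
    ht.swap₂₃ p (u 2) (u 1), ht.swap₂₃ p (u 0) (u 2), Matrix.cons_val_zero,
    Matrix.cons_val_one, Matrix.cons_val]
  ring

theorem exists_dotProduct_eq_one {a : Fin 3 → K} (ha : a ≠ 0) : ∃ s, a ⬝ᵥ s = 1 := by
  obtain ⟨i, hi⟩ := Function.ne_iff.1 ha
  exact ⟨Pi.single i (a i)⁻¹, by rw [dotProduct_single, mul_inv_cancel₀ hi]⟩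

namespace IsFrame

variable {v p q : V} {u : Fin 3 → V} {φ : V [⋀^Fin 3]→ₗ[K] K}

/-- If the form vanishes at `u`, it vanishes on the span of `u`. -/
theorem apply_frame_eq_zero (h0 : tri φ (u 0) (u 1) (u 2) = 0) {w : Fin 3 → V}
    (hw : ∀ i, ∃ c : Fin 3 → K, w i = ∑ j, c j • u j) : tri φ (w 0) (w 1) (w 2) = 0 := by
  have ht := isAlt₃_tri φ
  obtain ⟨x, hx⟩ := hw 0
  obtain ⟨y, hy⟩ := hw 1
  obtain ⟨z, hz⟩ := hw 2
  have h1 : tri φ (u 1) (u 2) (u 0) = 0 := by rw [← ht.rotate, h0]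
  have h2 : tri φ (u 2) (u 0) (u 1) = 0 := by rw [ht.rotate, h0]
  rw [hx, hy, hz, ht.apply_combination]
  have e : ![tri φ (∑ j, x j • u j) (u 1) (u 2), tri φ (∑ j, x j • u j) (u 2) (u 0),
      tri φ (∑ j, x j • u j) (u 0) (u 1)] = 0 := by
    funext i
    fin_cases i <;> simp [Fin.sum_univ_three, ht.left, ht.outer, h0, h1, h2]
  rw [e, zero_dotProduct]

/-- When the form does not vanish on the span of `u`, translations of `p` and `q` along this
span, and of `u` along `v`, bring it to the form `123 + 456`. -/
theorem hasModelT3_of_ne_zero (h6 : Module.finrank K V = 6) (h : IsFrame (tri φ) v p q u)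
    (h0 : tri φ (u 0) (u 1) (u 2) ≠ 0) :
    ∃ B : Module.Basis (Fin 6) K V, φ = assocForm (modelT3 B) := by
  have ht := isAlt₃_tri φ
  -- For each `w` there is a translate of `w` whose contraction vanishes on the span of `u`.
  have key : ∀ w : V, ∃ x : Fin 3 → K, ∀ i j, tri φ (w + ∑ k, x k • u k) (u i) (u j) = 0 := by
    intro w
    set d := tri φ (u 0) (u 1) (u 2) with hd
    have h1 : tri φ (u 1) (u 2) (u 0) = d := by rw [← ht.rotate]
    have h2 : tri φ (u 2) (u 0) (u 1) = d := by rw [ht.rotate]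
    let c : Fin 3 → K := ![-(d⁻¹ * tri φ w (u 1) (u 2)), -(d⁻¹ * tri φ w (u 2) (u 0)),
      -(d⁻¹ * tri φ w (u 0) (u 1))]
    refine ⟨c, ?_⟩
    have e01 : tri φ (w + ∑ k, c k • u k) (u 0) (u 1) = 0 := by
      simp only [Fin.sum_univ_three, map_add, map_smul, LinearMap.add_apply, LinearMap.smul_apply,
        ht.left, ht.outer, h2, smul_eq_mul, c, Matrix.cons_val_zero, Matrix.cons_val_one,
        Matrix.cons_val]
      field_simp; ring
    have e12 : tri φ (w + ∑ k, c k • u k) (u 1) (u 2) = 0 := by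
      simp only [Fin.sum_univ_three, map_add, map_smul, LinearMap.add_apply, LinearMap.smul_apply,
        ht.left, ht.outer, ← hd, smul_eq_mul, c, Matrix.cons_val_zero, Matrix.cons_val_one,
        Matrix.cons_val]
      field_simp; ring
    have e20 : tri φ (w + ∑ k, c k • u k) (u 2) (u 0) = 0 := by
      simp only [Fin.sum_univ_three, map_add, map_smul, LinearMap.add_apply, LinearMap.smul_apply,
        ht.left, ht.outer, h1, smul_eq_mul, c, Matrix.cons_val_zero, Matrix.cons_val_one,
        Matrix.cons_val]
      field_simp; ring
    generalize (w + ∑ k, c k • u k) = w' at *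
    intro i j
    fin_cases i <;> fin_cases j <;>
      simp [ht.right, e01, e12, e20, ht.swap₂₃ w' (u 1) (u 0), ht.swap₂₃ w' (u 2) (u 1),
        ht.swap₂₃ w' (u 0) (u 2)]
  obtain ⟨x, hx⟩ := key p
  obtain ⟨y, hy⟩ := key q
  have hvs : ∀ c : Fin 3 → K, tri φ v (∑ k, c k • u k) = 0 := fun c => by simp [h.vu]
  have hvs' : ∀ (c : Fin 3 → K) (w : V), tri φ v w (∑ k, c k • u k) = 0 := fun c w => by
    rw [ht.swap₂₃, hvs]; simp
  set p' := p + ∑ k, x k • u k with hp'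
  set q' := q + ∑ k, y k • u k with hq'
  have hvp : tri φ v p' = tri φ v p := by rw [hp', map_add, hvs, add_zero]
  have hvq : ∀ w, tri φ v w q' = tri φ v w q := fun w => by rw [hq', map_add, hvs', add_zero]
  have huv : ∀ (w : V) (i), tri φ w v (u i) = 0 := fun w i => by rw [ht.rotate, h.vu]; rfl
  have huv' : ∀ (w : V) (i), tri φ w (u i) v = 0 := fun w i => by rw [ht.swap₂₃, huv, neg_zero]
  have hone : tri φ v p' q' = 1 := by rw [hvp, hvq, h.one]
  have hd := h0
  -- Translating the `u i` along `v` makes them orthogonal to the new `p` and `q`.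
  let u' : Fin 3 → V := fun i => u i - tri φ (u i) p' q' • v
  have hval : ∀ (w : V) (i j), tri φ w (u' i) (u' j) = tri φ w (u i) (u j) := fun w i j => by
    simp [u', huv, huv', ht.right]
  have huuu : tri φ (u' 0) (u' 1) (u' 2) = tri φ (u 0) (u 1) (u 2) := by
    rw [hval]; simp [u', h.vu]
  set d := tri φ (u 0) (u 1) (u 2)
  have hfr : IsFrame (tri φ) v p' q' ![d⁻¹ • u' 0, u' 1, u' 2] := by
    refine ⟨⟨hone, fun a b => ?_⟩, fun i => ?_, fun i => ?_, fun i => ?_, ?_⟩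
    · rw [hvp, hvq, hvq, h.rank]
    · fin_cases i <;> simp [u', hone]
    · fin_cases i <;> simp [u', hvq, h.vuq, ht.left]
    · fin_cases i <;> simp [u', hvp, h.vpu, ht.outer]
    · refine linearIndependent_of_tri_ne_zero (φ := φ) ?_
      simp [huuu, hd]
  refine hfr.hasModelT3 h6 (fun i j => ?_) (fun i j => ?_) ?_
  · fin_cases i <;> fin_cases j <;> simp [hval, hx]
  · fin_cases i <;> fin_cases j <;> simp [hval, hy]
  · simp [huuu, hd]

/-- When the form vanishes on the span of `u` and the bilinear forms `t p`, `t q` are independent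
there, the type is `T₄`: their radicals are two of the vectors of the adapted frame. -/
theorem hasModelT4_of_cross_ne_zero (h6 : Module.finrank K V = 6) (h : IsFrame (tri φ) v p q u)
    (h0 : tri φ (u 0) (u 1) (u 2) = 0)
    (hne : ![tri φ p (u 1) (u 2), tri φ p (u 2) (u 0), tri φ p (u 0) (u 1)] ⨯₃
      ![tri φ q (u 1) (u 2), tri φ q (u 2) (u 0), tri φ q (u 0) (u 1)] ≠ 0) :
    ∃ B : Module.Basis (Fin 6) K V, φ = assocForm (modelT4 B) := by
  have ht := isAlt₃_tri φ
  have hp := ht.apply_combination p u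
  have hq := ht.apply_combination q u
  set a := ![tri φ p (u 1) (u 2), tri φ p (u 2) (u 0), tri φ p (u 0) (u 1)]
  set b := ![tri φ q (u 1) (u 2), tri φ q (u 2) (u 0), tri φ q (u 0) (u 1)]
  obtain ⟨s, hs⟩ := exists_dotProduct_eq_one hne
  rw [dotProduct_comm] at hs
  -- `a` and `b` are the coordinates of the radicals of the contractions by `p` and `q`.
  let w : Fin 3 → V := ![∑ j, s j • u j, ∑ j, b j • u j, ∑ j, a j • u j]
  have hw : ∀ i, ∃ c : Fin 3 → K, w i = ∑ j, c j • u j := by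
    intro i
    fin_cases i
    exacts [⟨s, rfl⟩, ⟨b, rfl⟩, ⟨a, rfl⟩]
  have hp01 : tri φ p (w 0) (w 1) = -1 := by
    change tri φ p (∑ j, s j • u j) (∑ j, b j • u j) = -1
    rw [hp, triple_product_permutation, ← cross_anticomm, dotProduct_neg, hs]
  have hp02 : tri φ p (w 0) (w 2) = 0 := by
    change tri φ p (∑ j, s j • u j) (∑ j, a j • u j) = 0
    rw [hp, dot_cross_self]
  have hp12 : tri φ p (w 1) (w 2) = 0 := by
    change tri φ p (∑ j, b j • u j) (∑ j, a j • u j) = 0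
    rw [hp, dot_cross_self]
  have hq01 : tri φ q (w 0) (w 1) = 0 := by
    change tri φ q (∑ j, s j • u j) (∑ j, b j • u j) = 0
    rw [hq, dot_cross_self]
  have hq02 : tri φ q (w 0) (w 2) = 1 := by
    change tri φ q (∑ j, s j • u j) (∑ j, a j • u j) = 1
    rw [hq, triple_product_permutation, hs]
  have hq12 : tri φ q (w 1) (w 2) = 0 := by
    change tri φ q (∑ j, b j • u j) (∑ j, a j • u j) = 0
    rw [hq, dot_self_cross]
  have hli : LinearIndependent K w := by
    rw [Fintype.linearIndependent_iff]
    intro c hc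
    rw [Fin.sum_univ_three] at hc
    have e0 := congrArg (fun z => tri φ p z (w 1)) hc
    have e1 := congrArg (fun z => tri φ p (w 0) z) hc
    have e2 := congrArg (fun z => tri φ q (w 0) z) hc
    simp [hp01, hp02, hq01, hq02, ht.right, ht.swap₂₃ p (w 2) (w 1), hp12] at e0 e1 e2
    intro i
    fin_cases i <;> assumption
  exact (h.change hli hw).hasModelT4 h6 hp01 hp02 hp12 hq01 hq02 hq12 (apply_frame_eq_zero h0 hw)

/-- When the form vanishes on the span of `u` and the bilinear form `t q` is a multiple of
`t p ≠ 0` there, a shear makes `t q` zero and the type is `T₂`. -/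
theorem hasModelT2_of_ne_zero (h6 : Module.finrank K V = 6) (h : IsFrame (tri φ) v p q u)
    (h0 : tri φ (u 0) (u 1) (u 2) = 0)
    (hcr : ![tri φ p (u 1) (u 2), tri φ p (u 2) (u 0), tri φ p (u 0) (u 1)] ⨯₃
      ![tri φ q (u 1) (u 2), tri φ q (u 2) (u 0), tri φ q (u 0) (u 1)] = 0)
    (hne : ![tri φ p (u 1) (u 2), tri φ p (u 2) (u 0), tri φ p (u 0) (u 1)] ≠ 0) :
    ∃ B : Module.Basis (Fin 6) K V, φ = assocForm (modelT2 B) := by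
  have ht := isAlt₃_tri φ
  have hp := ht.apply_combination p u
  have hq := ht.apply_combination q u
  set a := ![tri φ p (u 1) (u 2), tri φ p (u 2) (u 0), tri φ p (u 0) (u 1)] with ha
  set b := ![tri φ q (u 1) (u 2), tri φ q (u 2) (u 0), tri φ q (u 0) (u 1)]
  obtain ⟨k, hk⟩ := (cross_eq_zero_iff_exists hne).1 hcr
  obtain ⟨y, z, hyz⟩ : ∃ y z : Fin 3 → K, tri φ p (∑ j, y j • u j) (∑ j, z j • u j) = 1 := by
    have hex : ∃ y z : Fin 3 → K, tri φ p (∑ j, y j • u j) (∑ j, z j • u j) ≠ 0 := by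
      by_contra! hall
      have hall' : ∀ i j, tri φ p (u i) (u j) = 0 := fun i j => by
        have := hall (Pi.single i 1) (Pi.single j 1)
        simpa [Pi.single_apply] using this
      apply hne
      rw [ha]
      simp [hall']
    obtain ⟨y, z, hyz⟩ := hex
    refine ⟨(tri φ p (∑ j, y j • u j) (∑ j, z j • u j))⁻¹ • y, z, (hp _ _).trans ?_⟩
    rw [map_smul, LinearMap.smul_apply, dotProduct_smul, ← hp, smul_eq_mul, inv_mul_cancel₀ hyz]
  let w : Fin 3 → V := ![∑ j, y j • u j, ∑ j, z j • u j, ∑ j, a j • u j]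
  have hw : ∀ i, ∃ c : Fin 3 → K, w i = ∑ j, c j • u j := by
    intro i
    fin_cases i
    exacts [⟨y, rfl⟩, ⟨z, rfl⟩, ⟨a, rfl⟩]
  have h01 : tri φ p (w 0) (w 1) = 1 := hyz
  have h02 : tri φ p (w 0) (w 2) = 0 := by
    change tri φ p (∑ j, y j • u j) (∑ j, a j • u j) = 0
    rw [hp, dot_cross_self]
  have h12 : tri φ p (w 1) (w 2) = 0 := by
    change tri φ p (∑ j, z j • u j) (∑ j, a j • u j) = 0
    rw [hp, dot_cross_self]
  have hli : LinearIndependent K w := by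
    rw [Fintype.linearIndependent_iff]
    intro c hc
    rw [Fin.sum_univ_three] at hc
    have e0 := congrArg (fun z => tri φ p z (w 1)) hc
    have e1 := congrArg (fun z => tri φ p (w 0) z) hc
    simp [h01, h02, ht.right, ht.swap₂₃ p (w 2) (w 1), h12] at e0 e1
    have e2 : c 2 = 0 := by
      rw [e0, e1, zero_smul, zero_smul, zero_add, zero_add] at hc
      refine (smul_eq_zero.1 hc).resolve_right fun hw2 => hne ?_
      funext i
      exact Fintype.linearIndependent_iff.1 h.li a hw2 i
    intro i
    fin_cases i <;> assumption
  refine ((h.shear ht k).change hli hw).hasModelT2 h6 h01 h02 h12 (fun i j => ?_)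
    (apply_frame_eq_zero h0 hw)
  obtain ⟨c, hc⟩ := hw i
  obtain ⟨d, hd⟩ := hw j
  rw [hc, hd, map_sub, map_smul, LinearMap.sub_apply, LinearMap.sub_apply, LinearMap.smul_apply,
    LinearMap.smul_apply, hp, hq, hk, smul_dotProduct, sub_self]

end IsFrame

/-- A form with a vector whose contraction has rank two is of one of the types `T₁`, …, `T₄`. -/
theorem IsRankTwo.hasModel {φ : V [⋀^Fin 3]→ₗ[K] K} {v p q : V} (h6 : Module.finrank K V = 6)
    (h : IsRankTwo (tri φ) v p q) :
    ∃ B : Module.Basis (Fin 6) K V, φ = assocForm (modelT1 B) ∨ φ = assocForm (modelT2 B) ∨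
      φ = assocForm (modelT3 B) ∨ φ = assocForm (modelT4 B) := by
  have ht := isAlt₃_tri φ
  obtain ⟨u, hu⟩ := h.exists_isFrame ht h6
  by_cases h0 : tri φ (u 0) (u 1) (u 2) = 0
  swap
  · obtain ⟨B, hB⟩ := hu.hasModelT3_of_ne_zero h6 h0
    exact ⟨B, .inr (.inr (.inl hB))⟩
  by_cases hcr : ![tri φ p (u 1) (u 2), tri φ p (u 2) (u 0), tri φ p (u 0) (u 1)] ⨯₃
      ![tri φ q (u 1) (u 2), tri φ q (u 2) (u 0), tri φ q (u 0) (u 1)] = 0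
  swap
  · obtain ⟨B, hB⟩ := hu.hasModelT4_of_cross_ne_zero h6 h0 hcr
    exact ⟨B, .inr (.inr (.inr hB))⟩
  by_cases hp : ![tri φ p (u 1) (u 2), tri φ p (u 2) (u 0), tri φ p (u 0) (u 1)] = 0
  swap
  · obtain ⟨B, hB⟩ := hu.hasModelT2_of_ne_zero h6 h0 hcr hp
    exact ⟨B, .inr (.inl hB)⟩
  have hz : ∀ w : V, ![tri φ w (u 1) (u 2), tri φ w (u 2) (u 0), tri φ w (u 0) (u 1)] = 0 →
      ∀ i j, tri φ w (u i) (u j) = 0 := by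
    intro w hw i j
    have e0 : tri φ w (u 1) (u 2) = 0 := congrFun hw 0
    have e1 : tri φ w (u 2) (u 0) = 0 := congrFun hw 1
    have e2 : tri φ w (u 0) (u 1) = 0 := congrFun hw 2
    fin_cases i <;> fin_cases j <;>
      simp [ht.right, e0, e1, e2, ht.swap₂₃ w (u 1) (u 0), ht.swap₂₃ w (u 2) (u 1),
        ht.swap₂₃ w (u 0) (u 2)]
  by_cases hq : ![tri φ q (u 1) (u 2), tri φ q (u 2) (u 0), tri φ q (u 0) (u 1)] = 0
  · obtain ⟨B, hB⟩ := hu.hasModelT1 h6 (hz p hp) (hz q hq) h0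
    exact ⟨B, .inl hB⟩
  · obtain ⟨B, hB⟩ := (hu.rotate ht).hasModelT2_of_ne_zero h6 h0
      (by simp [hz p hp, ← Matrix.zero_empty]) hq
    exact ⟨B, .inr (.inl hB)⟩

/-! ### Forms without vectors of rank two -/

section Symplectic

variable {t : V →ₗ[K] V →ₗ[K] V →ₗ[K] K}

/-- For the rank to be two it suffices that `t v` vanishes on the orthogonal complement of the
hyperbolic pair `p`, `q`. -/
theorem IsRankTwo.of_restrict (ht : IsAlt₃ t) {v p q : V} (h1 : t v p q = 1)
    (h : ∀ x y, t v x q = 0 → t v p x = 0 → t v y q = 0 → t v p y = 0 → t v x y = 0) :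
    IsRankTwo t v p q := by
  refine ⟨h1, fun x y => ?_⟩
  have hqp : t v q p = -1 := by rw [ht.swap₂₃, h1]
  have := h (x - t v x q • p - t v p x • q) (y - t v y q • p - t v p y • q)
    (by simp [h1, ht.right]) (by simp [h1, ht.right]) (by simp [h1, ht.right])
    (by simp [h1, ht.right])
  simp only [map_sub, map_smul, LinearMap.sub_apply, LinearMap.smul_apply, smul_eq_mul, ht.right,
    h1, hqp, ht.swap₂₃ v q y, ht.swap₂₃ v x p] at this
  linear_combination this

/-- A contraction `t v` that is neither zero nor of rank two has rank four: there are two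
orthogonal hyperbolic pairs. -/
theorem exists_hyperbolic_pairs (ht : IsAlt₃ t) {v : V} (hv : t v ≠ 0)
    (h2 : ∀ p q, ¬ IsRankTwo t v p q) :
    ∃ p q r s, t v p q = 1 ∧ t v r s = 1 ∧ t v p r = 0 ∧ t v p s = 0 ∧ t v r q = 0 ∧
      t v s q = 0 := by
  obtain ⟨p, q, hpq⟩ : ∃ p q, t v p q = 1 := by
    have hex : ∃ p q, t v p q ≠ 0 := by
      by_contra! hall
      exact hv (LinearMap.ext₂ hall)
    obtain ⟨p, q, hpq⟩ := hex
    exact ⟨p, (t v p q)⁻¹ • q, by simp [hpq]⟩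
  have := mt (IsRankTwo.of_restrict ht hpq) (h2 p q)
  push Not at this
  obtain ⟨r, s, hrq, hpr, hsq, hps, hrs⟩ := this
  exact ⟨p, q, r, (t v r s)⁻¹ • s, hpq, by simp [hrs], hpr, by simp [hps], hrq, by simp [hsq]⟩

/-- The functionals dual to two hyperbolic pairs of `t v`. -/
noncomputable def pairsMap (t : V →ₗ[K] V →ₗ[K] V →ₗ[K] K) (v p q r s : V) :
    V →ₗ[K] (Fin 4 → K) :=
  LinearMap.pi ![(t v).flip q, t v p, (t v).flip s, t v r]

theorem pairsMap_apply (v p q r s x : V) :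
    pairsMap t v p q r s x = ![t v x q, t v p x, t v x s, t v r x] := by
  funext i; fin_cases i <;> rfl

theorem pairsMap_pairs (ht : IsAlt₃ t) {v p q r s : V} (hpq : t v p q = 1) (hrs : t v r s = 1)
    (hpr : t v p r = 0) (hps : t v p s = 0) (hrq : t v r q = 0) (hsq : t v s q = 0)
    (i : Fin 4) : pairsMap t v p q r s (![p, q, r, s] i) = Pi.single i 1 := by
  rw [pairsMap_apply]
  have hqs : t v q s = 0 := by rw [ht.swap₂₃, hsq, neg_zero]
  have hrp : t v r p = 0 := by rw [ht.swap₂₃, hpr, neg_zero]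
  funext j
  fin_cases i <;> fin_cases j <;> simp [ht.right, *]

/-- In dimension six the radical of `t v` is the orthogonal complement of two orthogonal hyperbolic
pairs: this complement is two-dimensional and contains `v`, so `t v` vanishes on it. -/
theorem ker_eq_ker_pairsMap (ht : IsAlt₃ t) (h6 : Module.finrank K V = 6) {v p q r s : V}
    (hpq : t v p q = 1) (hrs : t v r s = 1) (hpr : t v p r = 0) (hps : t v p s = 0)
    (hrq : t v r q = 0) (hsq : t v s q = 0) :
    LinearMap.ker (t v) = LinearMap.ker (pairsMap t v p q r s) := by
  have hv0 : v ≠ 0 := by rintro rfl; simp at hpq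
  have hv : pairsMap t v p q r s v = 0 := by
    rw [pairsMap_apply]; simp [ht.left, ht.outer]
  apply le_antisymm
  · intro x hx
    have hx : t v x = 0 := hx
    rw [LinearMap.mem_ker, pairsMap_apply, ht.swap₂₃ v p, ht.swap₂₃ v r, hx]
    simp
  · intro x hx
    by_cases hli : LinearIndependent K ![v, x]
    · -- The functional `t v x` vanishes on the basis formed by the pairs, `v` and `x`.
      have hF : ∀ j, pairsMap t v p q r s (![v, x] j) = 0 := by
        intro j; fin_cases j
        exacts [hv, hx]
      obtain ⟨B, hB⟩ := exists_basis_of_linearIndependent h6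
        (linearIndependent_append_ker _ (pairsMap_pairs ht hpq hrs hpr hps hrq hsq) hli hF)
      rw [LinearMap.mem_ker, pairsMap_apply] at hx
      have hxp := congrFun hx 1
      have hxq := congrFun hx 0
      have hxr := congrFun hx 3
      have hxs := congrFun hx 2
      simp at hxp hxq hxr hxs
      refine LinearMap.mem_ker.2 (B.ext fun i => ?_)
      rw [hB]
      fin_cases i
      · change t v x p = 0
        rw [ht.swap₂₃, hxp, neg_zero]
      · exact hxq
      · change t v x r = 0
        rw [ht.swap₂₃, hxr, neg_zero]
      · exact hxs
      · exact ht.outer v x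
      · exact ht.right v x
    · rw [linearIndependent_pair_iff_notMem_span hv0] at hli
      push Not at hli
      obtain ⟨c, rfl⟩ := hli
      rw [LinearMap.mem_ker]
      ext y
      simp [ht.left]

theorem finrank_ker_of_not_isRankTwo (ht : IsAlt₃ t) (h6 : Module.finrank K V = 6) {v : V}
    (hv : t v ≠ 0) (h2 : ∀ p q, ¬ IsRankTwo t v p q) :
    Module.finrank K (LinearMap.ker (t v)) = 2 := by
  have : FiniteDimensional K V := Module.finite_of_finrank_pos (by omega)
  obtain ⟨p, q, r, s, hpq, hrs, hpr, hps, hrq, hsq⟩ := exists_hyperbolic_pairs ht hv h2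
  rw [ker_eq_ker_pairsMap ht h6 hpq hrs hpr hps hrq hsq]
  exact finrank_ker_of_dual_family h6 _ _ (pairsMap_pairs ht hpq hrs hpr hps hrq hsq)

/-- An alternating trilinear form on a four-dimensional space has a nonzero radical. -/
theorem exists_radical_combination (ht : IsAlt₃ t) (w : Fin 4 → V) :
    ∃ c : Fin 4 → K, c ≠ 0 ∧ ∀ i j, t (∑ k, c k • w k) (w i) (w j) = 0 := by
  have red : ∀ z, t z (w 0) (w 1) = 0 → t z (w 0) (w 2) = 0 → t z (w 0) (w 3) = 0 →
      t z (w 1) (w 2) = 0 → t z (w 1) (w 3) = 0 → t z (w 2) (w 3) = 0 →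
      ∀ i j, t z (w i) (w j) = 0 := by
    intro z h01 h02 h03 h12 h13 h23 i j
    fin_cases i <;> fin_cases j <;>
      simp [ht.right, h01, h02, h03, h12, h13, h23, ht.swap₂₃ z (w 1) (w 0),
        ht.swap₂₃ z (w 2) (w 0), ht.swap₂₃ z (w 3) (w 0), ht.swap₂₃ z (w 2) (w 1),
        ht.swap₂₃ z (w 3) (w 1), ht.swap₂₃ z (w 3) (w 2)]
  -- The coefficients are the signed values of the form at the complementary triples.
  let c : Fin 4 → K := ![t (w 1) (w 2) (w 3), -t (w 0) (w 2) (w 3), t (w 0) (w 1) (w 3),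
    -t (w 0) (w 1) (w 2)]
  have s012 := ht.rotate (w 2) (w 0) (w 1)
  have s013 := ht.rotate (w 3) (w 0) (w 1)
  have s023 := ht.rotate (w 3) (w 0) (w 2)
  have s123 := ht.rotate (w 3) (w 1) (w 2)
  have m102 := ht.swap₁₂ (w 1) (w 0) (w 2)
  have m103 := ht.swap₁₂ (w 1) (w 0) (w 3)
  have m203 := ht.swap₁₂ (w 2) (w 0) (w 3)
  have m213 := ht.swap₁₂ (w 2) (w 1) (w 3)
  by_cases hc : c = 0
  · have h0 : t (w 1) (w 2) (w 3) = 0 := congrFun hc 0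
    have h1 : -t (w 0) (w 2) (w 3) = 0 := congrFun hc 1
    have h2 : t (w 0) (w 1) (w 3) = 0 := congrFun hc 2
    have h3 : -t (w 0) (w 1) (w 2) = 0 := congrFun hc 3
    rw [neg_eq_zero] at h1 h3
    refine ⟨Pi.single 0 1, by simp, ?_⟩
    have e : ∑ k, (Pi.single 0 1 : Fin 4 → K) k • w k = w 0 := by
      simp [Pi.single_apply]
    rw [e]
    exact red _ (ht.left _ _) (ht.left _ _) (ht.left _ _) h3 h2 h1
  · refine ⟨c, hc, ?_⟩
    apply red <;>
      simp only [Fin.sum_univ_four, map_add, map_smul, LinearMap.add_apply, LinearMap.smul_apply,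
        ht.left, ht.outer, smul_eq_mul, c, Matrix.cons_val_zero, Matrix.cons_val_one,
        Matrix.cons_val, s012, s013, s023, s123, m102, m103, m203, m213] <;>
      ring

/-- A nonzero form without vectors of rank two has zero radical, so all contractions have rank
four. -/
theorem tri_ne_zero_of_not_isRankTwo (ht : IsAlt₃ t) (h6 : Module.finrank K V = 6) (h0 : t ≠ 0)
    (h2 : ∀ v p q, ¬ IsRankTwo t v p q) {x : V} (hx : x ≠ 0) : t x ≠ 0 := by
  intro htx
  obtain ⟨w, hw⟩ : ∃ w, t w ≠ 0 := by
    by_contra! hall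
    exact h0 (LinearMap.ext hall)
  obtain ⟨p, q, r, s, hpq, hrs, hpr, hps, hrq, hsq⟩ := exists_hyperbolic_pairs ht hw (h2 w)
  have hwx : LinearIndependent K ![x, w] := by
    rw [linearIndependent_pair_iff_notMem_span hx]
    rintro c rfl
    exact hw (by rw [map_smul, htx, smul_zero])
  have htx' : ∀ y, t y x = 0 := fun y => by ext z; rw [ht.swap₁₂, htx]; simp
  have hker := ker_eq_ker_pairsMap ht h6 hpq hrs hpr hps hrq hsq
  have hFx : pairsMap t w p q r s x = 0 := by
    rw [← LinearMap.mem_ker, ← hker, LinearMap.mem_ker, htx']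
  have hFw : pairsMap t w p q r s w = 0 := by
    rw [← LinearMap.mem_ker, ← hker, LinearMap.mem_ker]
    ext; simp [ht.left]
  have hpairs := pairsMap_pairs ht hpq hrs hpr hps hrq hsq
  obtain ⟨B, hB⟩ := exists_basis_of_linearIndependent h6
    (linearIndependent_append_ker _ hpairs hwx (fun j => by fin_cases j; exacts [hFx, hFw]))
  have hB5 : B 5 = w := hB 5
  obtain ⟨c, hc, hcz⟩ := exists_radical_combination ht ![p, q, r, s]
  set z := ∑ k, c k • ![p, q, r, s] k with hz
  have hFz : pairsMap t w p q r s z = c := by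
    rw [hz, map_sum]
    funext j
    simp only [map_smul, hpairs]
    simp [Pi.single_apply]
  have hwz : t z w ≠ 0 := by
    intro h
    apply hc
    rw [← hFz, ← LinearMap.mem_ker, ← hker, LinearMap.mem_ker]
    ext y
    rw [ht.swap₁₂, h]; simp
  have hzero : ∀ i j, i ≠ 5 → j ≠ 5 → t z (B i) (B j) = 0 := by
    intro i j hi hj
    have hcases : ∀ i : Fin 6, i ≠ 5 → (∃ k : Fin 4, B i = ![p, q, r, s] k) ∨ B i = x := by
      intro i hi
      rw [hB]
      fin_cases i
      exacts [.inl ⟨0, rfl⟩, .inl ⟨1, rfl⟩, .inl ⟨2, rfl⟩, .inl ⟨3, rfl⟩, .inr rfl,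
        absurd rfl hi]
    rcases hcases i hi with ⟨k, hk⟩ | hk
    · rcases hcases j hj with ⟨l, hl⟩ | hl
      · rw [hk, hl, hcz]
      · rw [hl, ht.swap₂₃, htx']; simp
    · rw [hk, htx']; rfl
  have hzero' : ∀ y y', B.repr y 5 = 0 → B.repr y' 5 = 0 → t z y y' = 0 := by
    intro y y' hy hy'
    rw [← B.sum_repr y, ← B.sum_repr y', map_sum]
    refine Finset.sum_eq_zero fun j _ => ?_
    rw [map_sum, LinearMap.sum_apply]
    refine Finset.sum_eq_zero fun i _ => ?_
    by_cases hi : i = 5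
    · subst hi; simp [hy]
    by_cases hj : j = 5
    · subst hj; simp [hy']
    simp [hzero i j hi hj]
  obtain ⟨y, hy⟩ : ∃ y, t z w y = 1 := by
    obtain ⟨y, hy⟩ : ∃ y, t z w y ≠ 0 := by
      by_contra! hall
      exact hwz (LinearMap.ext hall)
    exact ⟨(t z w y)⁻¹ • y, by simp [hy]⟩
  -- Modulo the hyperplane spanned by the other basis vectors, only `w` contributes to `t z`.
  have hcoord : ∀ a, t z w a = 0 → t z a y = B.repr a 5 := by
    intro a ha
    have ha' : t z a w = 0 := by rw [ht.swap₂₃, ha, neg_zero]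
    have := hzero' (a - B.repr a 5 • w) (y - B.repr y 5 • w) (by simp [← hB5]) (by simp [← hB5])
    simp [hy, ha', ht.right] at this
    linear_combination this
  exact h2 z w y (IsRankTwo.of_restrict ht hy fun a b ha ha' hb hb' =>
    hzero' a b ((hcoord a ha').symm.trans ha) ((hcoord b hb').symm.trans hb))

end Symplectic

/-! ### The spread of kernels and the quadratic extension -/

/-- A normal form: the pairs `(a, a')`, `(b, b')`, `(c, c')` are isotropic, `(c, c')` is dual to
the functionals `t a b`, `t a b'`, and multiplication by `a'` instead of `a` is the companion
matrix of `X² - τ X + δ`. -/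
structure IsQuadratic (t : V →ₗ[K] V →ₗ[K] V →ₗ[K] K) (τ δ : K) (a a' b b' c c' : V) : Prop where
  aa : t a a' = 0
  bb : t b b' = 0
  cc : t c c' = 0
  symm : t a' b = t a b'
  quad : t a' b' = τ • t a b' - δ • t a b
  abc : t a b c = 1
  abc' : t a b c' = 0
  ab'c : t a b' c = 0
  ab'c' : t a b' c' = 1

section Kernels

variable {t : V →ₗ[K] V →ₗ[K] V →ₗ[K] K}

/-- When all kernels are two-dimensional, a nonzero vector lies in only one of them. -/
theorem ker_eq_of_mem_ker [FiniteDimensional K V] (ht : IsAlt₃ t)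
    (hk : ∀ x, x ≠ 0 → Module.finrank K (LinearMap.ker (t x)) = 2) {x y : V}
    (hx : x ≠ 0) (hy : y ≠ 0) (h : t x y = 0) : LinearMap.ker (t y) = LinearMap.ker (t x) := by
  have hxx : ∀ z, t z z = 0 := fun z => LinearMap.ext (ht.left z)
  have hyx : t y x = 0 := by ext z; rw [ht.swap₁₂, h]; simp
  by_cases hli : LinearIndependent K ![x, y]
  · rw [eq_span_pair (hk x hx) (hxx x) h hli, eq_span_pair (hk y hy) hyx (hxx y) hli]
  · rw [linearIndependent_pair_iff_notMem_span hx] at hli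
    push Not at hli
    obtain ⟨c, rfl⟩ := hli
    have hc : c ≠ 0 := by rintro rfl; simp at hy
    rw [map_smul, LinearMap.ker_smul _ _ hc]

theorem tri_eq_zero_of_mem_ker [FiniteDimensional K V] (ht : IsAlt₃ t)
    (hk : ∀ x, x ≠ 0 → Module.finrank K (LinearMap.ker (t x)) = 2) {a x y : V}
    (ha : a ≠ 0) (hx : t a x = 0) (hy : t a y = 0) : t x y = 0 := by
  by_cases hx0 : x = 0
  · rw [hx0, map_zero]; rfl
  · have : y ∈ LinearMap.ker (t x) := by
      rw [ker_eq_of_mem_ker ht hk ha hx0 hx]; exact hy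
    exact this

/-- If all contractions have rank four, their kernels form a spread; three of its members that
span the space give the normal form, with an irreducible quadratic polynomial. -/
theorem exists_isQuadratic (ht : IsAlt₃ t) (h6 : Module.finrank K V = 6)
    (hk : ∀ x, x ≠ 0 → Module.finrank K (LinearMap.ker (t x)) = 2) :
    ∃ (τ δ : K) (a a' b b' c c' : V), IsQuadratic t τ δ a a' b b' c c' ∧
      ∀ k : K, k ^ 2 - τ * k + δ ≠ 0 := by
  have : FiniteDimensional K V := Module.finite_of_finrank_pos (by omega)
  have hself : ∀ z, t z z = 0 := fun z => LinearMap.ext (ht.left z)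
  have hswap : ∀ x y, t x y = -t y x := fun x y => by ext z; rw [ht.swap₁₂]; simp
  have : Nontrivial V := Module.nontrivial_of_finrank_pos (R := K) (by omega)
  obtain ⟨a, ha⟩ := exists_ne (0 : V)
  set A := LinearMap.ker (t a) with hA
  have hA2 : Module.finrank K A = 2 := hk a ha
  obtain ⟨b, hbA⟩ : ∃ b, b ∉ A := by
    by_contra! hall
    rw [(Submodule.eq_top_iff' (p := A)).2 hall, finrank_top] at hA2
    omega
  have hb : b ≠ 0 := by rintro rfl; exact hbA A.zero_mem
  set B := LinearMap.ker (t b) with hB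
  have hB2 : Module.finrank K B = 2 := hk b hb
  have hAB : ∀ x ∈ A, x ∈ B → x = 0 := by
    intro x hxA hxB
    by_contra hx
    apply hbA
    rw [hA, ← ker_eq_of_mem_ker ht hk ha hx hxA, ker_eq_of_mem_ker ht hk hb hx hxB]
    exact hself b
  have hAA : ∀ x ∈ A, ∀ y ∈ A, t x y = 0 := fun x hx y hy =>
    tri_eq_zero_of_mem_ker ht hk ha hx hy
  have hBB : ∀ x ∈ B, ∀ y ∈ B, t x y = 0 := fun x hx y hy =>
    tri_eq_zero_of_mem_ker ht hk hb hx hy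
  have hne : ∀ x ∈ A, ∀ y ∈ B, t x y = 0 → x ≠ 0 → y = 0 := by
    intro x hx y hy hxy hx0
    refine hAB y ?_ hy
    rw [hA, ← ker_eq_of_mem_ker ht hk ha hx0 hx]
    exact hxy
  -- All contractions of two vectors of `W = A ⊕ B` lie in the two-dimensional annihilator `N`.
  set W := A ⊔ B with hW
  have hW4 : Module.finrank K W = 4 := by
    have h := Submodule.finrank_sup_add_finrank_inf_eq A B
    have hinf : A ⊓ B = ⊥ := by
      rw [Submodule.eq_bot_iff]
      exact fun x hx => hAB x hx.1 hx.2
    rw [hinf, finrank_bot, hA2, hB2] at h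
    omega
  set N := W.dualAnnihilator with hN
  have hN2 : Module.finrank K N = 2 := by
    have : Module.finrank K W + Module.finrank K N = Module.finrank K V :=
      Subspace.finrank_add_finrank_dualAnnihilator_eq W
    rw [hW4, h6] at this
    omega
  have hABN : ∀ x ∈ A, ∀ y ∈ B, t x y ∈ N := by
    intro x hx y hy
    rw [hN, Submodule.mem_dualAnnihilator]
    intro w hw
    obtain ⟨x', hx', y', hy', rfl⟩ := Submodule.mem_sup.1 hw
    rw [map_add, ht.swap₂₃, hAA x hx x' hx', ht.rotate, hBB y hy y' hy']
    simp
  have hWN : ∀ x ∈ W, ∀ y ∈ W, t x y ∈ N := by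
    intro x hx y hy
    obtain ⟨x₁, hx₁, x₂, hx₂, rfl⟩ := Submodule.mem_sup.1 hx
    obtain ⟨y₁, hy₁, y₂, hy₂, rfl⟩ := Submodule.mem_sup.1 hy
    rw [map_add, map_add, LinearMap.add_apply, LinearMap.add_apply, hAA _ hx₁ _ hy₁,
      hBB _ hx₂ _ hy₂, hswap x₂ y₁, zero_add, add_zero]
    exact N.add_mem (N.neg_mem (hABN _ hy₁ _ hx₂)) (hABN _ hx₁ _ hy₂)
  have haA : a ∈ A := hself a
  have hbB : b ∈ B := hself b
  obtain ⟨a', ha'A, haa'⟩ := exists_linearIndependent_pair hA2 haA ha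
  obtain ⟨b', hb'B, hb'⟩ : ∃ b' ∈ B, t a b' = t a' b := by
    let f : B →ₗ[K] N := (t a).restrict fun y hy => hABN a haA y hy
    have hf : Function.Injective f := by
      rw [injective_iff_map_eq_zero]
      intro y hy
      exact Subtype.ext (hne a haA y y.2 (congrArg Subtype.val hy) ha)
    have hfs : Function.Surjective f :=
      (LinearMap.injective_iff_surjective_of_finrank_eq_finrank (V := B) (V₂ := N)
        (hB2.trans hN2.symm)).1 hf
    obtain ⟨y, hy⟩ := hfs ⟨t a' b, hABN a' ha'A b hbB⟩
    exact ⟨y, y.2, congrArg Subtype.val hy⟩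
  have hNli : LinearIndependent K ![t a b, t a b'] := by
    rw [LinearIndependent.pair_iff] at haa' ⊢
    intro r s hrs
    apply haa'
    by_contra h0
    refine hb (hne _ (A.add_mem (A.smul_mem r haA) (A.smul_mem s ha'A)) b hbB ?_ h0)
    rw [map_add, map_smul, map_smul, LinearMap.add_apply, LinearMap.smul_apply,
      LinearMap.smul_apply, ← hb', hrs]
  have hNspan := eq_span_pair hN2 (hABN a haA b hbB) (hABN a haA b' hb'B) hNli
  obtain ⟨δ, τ, hquad⟩ := Submodule.mem_span_pair.1 (hNspan ▸ hABN a' ha'A b' hb'B)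
  -- A member of the spread that is not in `W` is a complement of `W`.
  obtain ⟨c, hcW⟩ : ∃ c, c ∉ W := by
    by_contra! hall
    rw [(Submodule.eq_top_iff' (p := W)).2 hall, finrank_top] at hW4
    omega
  have hc : c ≠ 0 := by rintro rfl; exact hcW W.zero_mem
  have hkerW : ∀ w ∈ W, w ≠ 0 → LinearMap.ker (t w) ≤ W := by
    intro w hw hw0
    let f : W →ₗ[K] N := (t w).restrict fun y hy => hWN w hw y hy
    have h1 := LinearMap.finrank_range_add_finrank_ker (V := W) (V₂ := N) f
    have h2 := Submodule.finrank_le (LinearMap.range f)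
    have h3 : (LinearMap.ker f).map W.subtype ≤ LinearMap.ker (t w) := by
      rintro _ ⟨y, hy, rfl⟩
      exact congrArg Subtype.val hy
    have h4 := Submodule.finrank_map_subtype_eq W (LinearMap.ker f)
    have h5 := hk w hw0
    have h6 := Submodule.finrank_mono h3
    rw [← Submodule.eq_of_le_of_finrank_eq h3 (by omega)]
    exact Submodule.map_subtype_le W _
  have hCW : ∀ x, t c x = 0 → x ∈ W → x = 0 := by
    intro x hcx hxW
    by_contra hx
    apply hcW
    apply hkerW x hxW hx
    rw [ker_eq_of_mem_ker ht hk hc hx hcx]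
    exact hself c
  let g : LinearMap.ker (t c) →ₗ[K] K × K :=
    ((t a b).prod (t a b')).domRestrict (LinearMap.ker (t c))
  have hg : Function.Injective g := by
    rw [injective_iff_map_eq_zero]
    intro x hx
    have hx1 : t a b x = 0 := congrArg Prod.fst hx
    have hx2 : t a b' x = 0 := congrArg Prod.snd hx
    refine Subtype.ext (hCW x x.2 ?_)
    rw [← Subspace.dualAnnihilator_dualCoannihilator_eq (W := W), Submodule.mem_dualCoannihilator]
    intro ψ hψ
    have hψN : ψ ∈ N := hψ
    obtain ⟨r, s, rfl⟩ := Submodule.mem_span_pair.1 (hNspan ▸ hψN)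
    simp [hx1, hx2]
  have hgs := (LinearMap.injective_iff_surjective_of_finrank_eq_finrank
    ((hk c hc).trans (by simp))).1 hg
  obtain ⟨c₁, hc₁⟩ := hgs (1, 0)
  obtain ⟨c₂, hc₂⟩ := hgs (0, 1)
  refine ⟨τ, -δ, a, a', b, b', c₁, c₂, ⟨ha'A, hb'B,
    tri_eq_zero_of_mem_ker ht hk hc c₁.2 c₂.2, hb'.symm, ?_, congrArg Prod.fst hc₁,
    congrArg Prod.fst hc₂, congrArg Prod.snd hc₁, congrArg Prod.snd hc₂⟩, fun k hroot => ?_⟩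
  · rw [← hquad]; module
  · -- A root gives nonzero vectors of `A` and `B` with zero contraction.
    have h0 : t (a' - k • a) (b' - (τ - k) • b) = 0 := by
      simp only [map_sub, map_smul, LinearMap.sub_apply, LinearMap.smul_apply, ← hquad, ← hb']
      have : δ = k ^ 2 - τ * k := by linear_combination (-1) * hroot
      rw [this]
      module
    rw [LinearIndependent.pair_iff] at haa' hNli
    have h1 : a' - k • a ≠ 0 := fun h => one_ne_zero (α := K) (haa' (-k) 1 (by rw [← h]; module)).2
    have h2 := hne _ (A.sub_mem ha'A (A.smul_mem k haA)) _
      (B.sub_mem hb'B (B.smul_mem (τ - k) hbB)) h0 h1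
    refine one_ne_zero (α := K) (hNli (-(τ - k)) 1 ?_).2
    rw [sub_eq_zero.1 h2, map_smul]
    module

end Kernels

namespace IsQuadratic

variable {t : V →ₗ[K] V →ₗ[K] V →ₗ[K] K} {τ δ : K} {a a' b b' c c' : V}

/-- The normal form with respect to the generator `α μ + β` of the quadratic extension. -/
theorem change_generator (ht : IsAlt₃ t) (h : IsQuadratic t τ δ a a' b b' c c') {α : K}
    (hα : α ≠ 0) (β : K) :
    IsQuadratic t (α * τ + 2 * β) (α ^ 2 * δ + α * β * τ + β ^ 2) a (α • a' + β • a) b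
      (α • b' + β • b) (c - (α⁻¹ * β) • c') (α⁻¹ • c') := by
  have hself : ∀ z, t z z = 0 := fun z => LinearMap.ext (ht.left z)
  constructor
  · simp [h.aa, hself]
  · simp [h.bb, hself]
  · simp [h.cc, hself]
  · simp [h.symm]
  · simp only [map_add, map_smul, LinearMap.add_apply, LinearMap.smul_apply, h.symm, h.quad]
    module
  · simp [h.abc, h.abc']
  · simp [h.abc']
  · simp [h.abc, h.abc', h.ab'c, h.ab'c', hα]
  · simp [h.abc', h.ab'c', hα]

/-- The six vectors form a basis, and so they do with any other basis of `⟨c, c'⟩`. -/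
theorem exists_basis (ht : IsAlt₃ t) (h6 : Module.finrank K V = 6)
    (h : IsQuadratic t τ δ a a' b b' c c') {k l m n : K} (hdet : k * n - l * m ≠ 0) :
    ∃ B : Module.Basis (Fin 6) K V,
      ∀ i, B i = ![a, b, k • c + l • c', a', b', m • c + n • c'] i := by
  apply exists_basis_of_linearIndependent h6
  have hself : ∀ z, t z z = 0 := fun z => LinearMap.ext (ht.left z)
  rw [Fintype.linearIndependent_iff]
  intro r hr
  simp only [Fin.sum_univ_six, Matrix.cons_val_zero, Matrix.cons_val_one, Matrix.cons_val] at hr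
  have hcbc : ∀ z, t c z c' = 0 := fun z => by rw [ht.swap₂₃, h.cc]; simp
  have hc'c : ∀ z, t c' z c = 0 := fun z => by rw [ht.swap₁₃, hcbc, neg_zero]
  have hb'bc : ∀ z, t b' b z = 0 := fun z => by rw [ht.swap₁₂, h.bb]; simp
  have e0 := congrArg (fun z => t z b c) hr
  have e1 := congrArg (fun z => t a z c) hr
  have e2 := congrArg (fun z => t a b z) hr
  have e3 := congrArg (fun z => t z b c') hr
  have e4 := congrArg (fun z => t a z c') hr
  have e5 := congrArg (fun z => t a b' z) hr
  have hac : ∀ z, t a z a = 0 := fun z => ht.outer a z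
  have haa' : ∀ z, t a z a' = 0 := fun z => by rw [ht.swap₂₃, h.aa]; simp
  have hbb' : ∀ z, t z b b' = 0 := fun z => by rw [ht.rotate, h.bb]; simp
  have hbb : ∀ z, t z b' b = 0 := fun z => by rw [ht.swap₂₃, hbb', neg_zero]
  have hcc : ∀ z, t z c c' = 0 := fun z => by rw [ht.rotate, h.cc]; simp
  have hcc' : ∀ z, t z c' c = 0 := fun z => by rw [ht.swap₂₃, hcc, neg_zero]
  simp [hself, h.symm, h.abc, h.abc', h.ab'c, h.ab'c', hcbc, hc'c, hb'bc, ht.outer, h.aa, hcc,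
    hcc', ht.right] at e0 e1 e3 e4
  simp [hac, haa', ht.right, hbb', hbb, h.abc, h.abc', h.ab'c, h.ab'c'] at e2 e5
  have e2' : r 2 = 0 := by
    refine (mul_eq_zero.1 ?_).resolve_left hdet
    linear_combination n * e2 - m * e5
  have e5' : r 5 = 0 := by
    refine (mul_eq_zero.1 ?_).resolve_left hdet
    linear_combination k * e5 - l * e2
  intro i
  fin_cases i <;> assumption

end IsQuadratic

/-! ### Recognition of the types T₁₀ -/

/-- Two forms for which the planes `⟨e₁, e₄⟩`, `⟨e₂, e₅⟩`, `⟨e₃, e₆⟩` are isotropic agree if they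
agree at the eight triples with one vector in each plane. -/
theorem ext_eight (B : Module.Basis (Fin 6) K V) {φ ψ : V [⋀^Fin 3]→ₗ[K] K}
    (a : tri φ (B 0) (B 3) = 0) (a' : tri ψ (B 0) (B 3) = 0)
    (b : tri φ (B 1) (B 4) = 0) (b' : tri ψ (B 1) (B 4) = 0)
    (c : tri φ (B 2) (B 5) = 0) (c' : tri ψ (B 2) (B 5) = 0)
    (h012 : tri φ (B 0) (B 1) (B 2) = tri ψ (B 0) (B 1) (B 2))
    (h015 : tri φ (B 0) (B 1) (B 5) = tri ψ (B 0) (B 1) (B 5))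
    (h042 : tri φ (B 0) (B 4) (B 2) = tri ψ (B 0) (B 4) (B 2))
    (h045 : tri φ (B 0) (B 4) (B 5) = tri ψ (B 0) (B 4) (B 5))
    (h312 : tri φ (B 3) (B 1) (B 2) = tri ψ (B 3) (B 1) (B 2))
    (h315 : tri φ (B 3) (B 1) (B 5) = tri ψ (B 3) (B 1) (B 5))
    (h342 : tri φ (B 3) (B 4) (B 2) = tri ψ (B 3) (B 4) (B 2))
    (h345 : tri φ (B 3) (B 4) (B 5) = tri ψ (B 3) (B 4) (B 5)) : φ = ψ := by
  have ht := isAlt₃_tri φ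
  have ht' := isAlt₃_tri ψ
  have mid : ∀ {t : V →ₗ[K] V →ₗ[K] V →ₗ[K] K}, IsAlt₃ t → ∀ {x y : V}, t x y = 0 →
      ∀ z, t x z y = 0 := fun h x y e z => by rw [h.swap₂₃, e]; simp
  have last : ∀ {t : V →ₗ[K] V →ₗ[K] V →ₗ[K] K}, IsAlt₃ t → ∀ {x y : V}, t x y = 0 →
      ∀ z, t z x y = 0 := fun h x y e z => by rw [h.rotate, e]; simp
  refine ext_twenty B h012 ?_ ?_ h015 ?_ ?_ ?_ ?_ ?_ h045 ?_ ?_ ?_ ?_ ?_ ?_ ?_ ?_ ?_ h345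
  · rw [mid ht a, mid ht' a']
  · rw [last ht b, last ht' b']
  · rw [mid ht a, mid ht' a']
  · rw [ht.swap₂₃, ht'.swap₂₃, h042]
  · rw [last ht c, last ht' c']
  · rw [a, a']
  · rw [a, a']
  · rw [← ht.rotate, ← ht'.rotate, h312]
  · rw [mid ht b, mid ht' b']
  · rw [last ht c, last ht' c']
  · rw [ht.swap₂₃, ht'.swap₂₃, b, b']
  · rw [ht.swap₁₂, ht'.swap₁₂, h315]
  · rw [b, b']
  · rw [ht.rotate, ht'.rotate, h342]
  · rw [mid ht c, mid ht' c']
  · rw [mid ht c, mid ht' c']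

theorem modelT10₁_isotropic (B : Module.Basis (Fin 6) K V) (c : K) :
    tri (assocForm (modelT10₁ B c)) (B 0) (B 3) = 0 ∧
    tri (assocForm (modelT10₁ B c)) (B 1) (B 4) = 0 ∧
    tri (assocForm (modelT10₁ B c)) (B 2) (B 5) = 0 := by
  refine ⟨?_, ?_, ?_⟩ <;>
  · ext z
    simp [modelT10₁, assocForm_add, assocForm_smul, tri_smul, tri_add, tri_wedge]

theorem modelT10₂_isotropic (B : Module.Basis (Fin 6) K V) (c : K) :
    tri (assocForm (modelT10₂ B c)) (B 0) (B 3) = 0 ∧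
    tri (assocForm (modelT10₂ B c)) (B 1) (B 4) = 0 ∧
    tri (assocForm (modelT10₂ B c)) (B 2) (B 5) = 0 := by
  refine ⟨?_, ?_, ?_⟩ <;>
  · ext z
    simp [modelT10₂, assocForm_add, assocForm_smul, tri_smul, tri_add, tri_wedge]

namespace IsQuadratic

variable {φ : V [⋀^Fin 3]→ₗ[K] K} {τ δ : K} {a a' b b' c c' : V}

theorem hasModelT10₁ (h6 : Module.finrank K V = 6)
    (h : IsQuadratic (tri φ) 0 δ a a' b b' c c') (hδ : δ ≠ 0) :
    ∃ B : Module.Basis (Fin 6) K V, φ = assocForm (modelT10₁ B (-δ)) := by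
  have ht := isAlt₃_tri φ
  obtain ⟨B, hB⟩ := h.exists_basis ht h6 (k := 1) (l := 0) (m := 0) (n := -δ) (by simpa using hδ)
  refine ⟨B, ?_⟩
  have h0 : B 0 = a := hB 0
  have h1 : B 1 = b := hB 1
  have h2 : B 2 = c := by simpa using hB 2
  have h3 : B 3 = a' := hB 3
  have h4 : B 4 = b' := hB 4
  have h5 : B 5 = (-δ) • c' := by simpa using hB 5
  apply ext_eight B
  · rw [h0, h3, h.aa]
  · exact (modelT10₁_isotropic B _).1
  · rw [h1, h4, h.bb]
  · exact (modelT10₁_isotropic B _).2.1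
  · rw [h2, h5, map_smul, h.cc, smul_zero]
  · exact (modelT10₁_isotropic B _).2.2
  all_goals
    simp only [modelT10₁, assocForm_add, assocForm_smul, tri_smul, tri_add, LinearMap.add_apply,
      LinearMap.smul_apply, tri_wedge, Module.Basis.repr_self]
    simp [h0, h1, h2, h3, h4, h5, h.abc, h.abc', h.ab'c, h.ab'c', h.symm, h.quad]

theorem hasModelT10₂ [CharP K 2] (h6 : Module.finrank K V = 6)
    (h : IsQuadratic (tri φ) τ 1 a a' b b' c c') :
    ∃ B : Module.Basis (Fin 6) K V, φ = assocForm (modelT10₂ B τ) := by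
  have ht := isAlt₃_tri φ
  obtain ⟨B, hB⟩ := h.exists_basis ht h6 (k := 0) (l := 1) (m := 1) (n := τ) (by simp)
  refine ⟨B, ?_⟩
  have h0 : B 0 = a := hB 0
  have h1 : B 1 = b := hB 1
  have h2 : B 2 = c' := by simpa using hB 2
  have h3 : B 3 = a' := hB 3
  have h4 : B 4 = b' := hB 4
  have h5 : B 5 = c + τ • c' := by simpa using hB 5
  have hcc : tri φ c' c = 0 := by ext z; rw [ht.swap₁₂, h.cc]; simp
  have hself : tri φ c' c' = 0 := LinearMap.ext (ht.left c')
  apply ext_eight B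
  · rw [h0, h3, h.aa]
  · exact (modelT10₂_isotropic B _).1
  · rw [h1, h4, h.bb]
  · exact (modelT10₂_isotropic B _).2.1
  · rw [h2, h5, map_add, map_smul, hcc, hself, smul_zero, add_zero]
  · exact (modelT10₂_isotropic B _).2.2
  all_goals
    simp only [modelT10₂, assocForm_add, assocForm_smul, tri_smul, tri_add, LinearMap.add_apply,
      LinearMap.smul_apply, tri_wedge, Module.Basis.repr_self]
    simp [h0, h1, h2, h3, h4, h5, h.abc, h.abc', h.ab'c, h.ab'c', h.symm, h.quad]
  rw [sub_eq_add_neg, CharTwo.neg_eq]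
  ring

end IsQuadratic

open Polynomial in
theorem irreducible_quadratic {p : K[X]} (hp : p.natDegree = 2) (h : ∀ k, p.eval k ≠ 0) :
    Irreducible p :=
  Polynomial.irreducible_of_degree_le_three_of_not_isRoot (by rw [hp]; decide) h

open Polynomial in
/-- A form without vectors of rank two is of one of the types `T₁₀`. -/
theorem exists_modelT10 {φ : V [⋀^Fin 3]→ₗ[K] K} (h6 : Module.finrank K V = 6) (h0 : φ ≠ 0)
    (h2 : ∀ v p q, ¬ IsRankTwo (tri φ) v p q) :
    ∃ (c : K) (B : Module.Basis (Fin 6) K V),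
      (Irreducible (X ^ 2 - C c : K[X]) ∧ φ = assocForm (modelT10₁ B c)) ∨
      (CharP K 2 ∧ Irreducible (X ^ 2 + C c * X + 1 : K[X]) ∧ φ = assocForm (modelT10₂ B c)) := by
  have ht := isAlt₃_tri φ
  have ht0 : tri φ ≠ 0 := mt (tri_eq_zero_iff φ).1 h0
  obtain ⟨τ, δ, a, a', b, b', c, c', hq, hirr⟩ := exists_isQuadratic ht h6 fun x hx =>
    finrank_ker_of_not_isRankTwo ht h6 (tri_ne_zero_of_not_isRankTwo ht h6 ht0 h2 hx) (h2 x)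
  -- With trace zero, the form is of the first kind.
  have hzero : ∀ {δ : K} {a a' b b' c c' : V}, IsQuadratic (tri φ) 0 δ a a' b b' c c' →
      (∀ k : K, k ^ 2 + δ ≠ 0) → ∃ (c : K) (B : Module.Basis (Fin 6) K V),
        Irreducible (X ^ 2 - C c : K[X]) ∧ φ = assocForm (modelT10₁ B c) := by
    intro δ a a' b b' c c' hq hirr
    obtain ⟨B, hB⟩ := hq.hasModelT10₁ h6 (by simpa using hirr 0)
    refine ⟨-δ, B, irreducible_quadratic (by compute_degree!) fun k => ?_, hB⟩
    simpa using hirr k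
  by_cases hchar : (2 : K) = 0
  · by_cases hτ : τ = 0
    · subst hτ
      obtain ⟨c, B, h⟩ := hzero hq (by simpa using hirr)
      exact ⟨c, B, .inl h⟩
    · have hc2 : CharP K 2 := CharTwo.of_one_ne_zero_of_two_eq_zero one_ne_zero hchar
      have hδ : δ ≠ 0 := by simpa using hirr 0
      -- The quotient of the generator by its conjugate is a generator of norm one.
      have hq' := hq.change_generator ht (div_ne_zero hτ hδ) 1
      have e1 : (τ / δ) ^ 2 * δ + τ / δ * 1 * τ + 1 ^ 2 = 1 := by
        have : (τ / δ) ^ 2 * δ = τ / δ * τ := by field_simp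
        rw [this, mul_one, CharTwo.add_self_eq_zero]
        ring
      have e2 : τ / δ * τ + 2 * 1 = τ ^ 2 / δ := by rw [hchar]; ring
      rw [e1, e2] at hq'
      obtain ⟨B, hB⟩ := hq'.hasModelT10₂ h6
      refine ⟨τ ^ 2 / δ, B, .inr ⟨hc2, irreducible_quadratic (by compute_degree!) fun k hk => ?_,
        hB⟩⟩
      -- A root of the new polynomial gives one of the old polynomial.
      refine hirr (δ / τ * (k + 1)) ?_
      simp only [eval_add, eval_mul, eval_pow, eval_X, eval_C, eval_one] at hk
      have e3 : (δ / τ * (k + 1)) ^ 2 - τ * (δ / τ * (k + 1)) + δ =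
          (δ / τ) ^ 2 * ((k ^ 2 + τ ^ 2 / δ * k + 1) + 2 * k * (1 - τ ^ 2 / δ)) := by
        field_simp
        ring
      rw [e3, hk, hchar]
      ring
  · have hq' := hq.change_generator ht one_ne_zero (-(τ / 2))
    have e1 : 1 * τ + 2 * -(τ / 2) = 0 := by field_simp; ring
    rw [e1] at hq'
    obtain ⟨c, B, h⟩ := hzero hq' fun k hk => hirr (k + τ / 2) (by
      rw [← hk]; field_simp; ring)
    exact ⟨c, B, .inl h⟩

end AltForm

theorem mainTheorem8 {K : Type u} {V : Type v} [Field K] [AddCommGroup V] [Module K V]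
    (E : Module.Basis (Fin 6) K V) (h : Module.Dual K (⋀[K]^3 V)) (hne : h ≠ 0) :
    -- every non-zero functional has one of the listed types
    (HasTypeT1 E h ∨ HasTypeT2 E h ∨ HasTypeT3 E h ∨ HasTypeT4 E h ∨
      ∃ c : K, HasTypeT10₁ E c h ∨ HasTypeT10₂ E c h) ∧
    -- type T1
    (HasTypeT1 E h →
      formRank (assocForm h) = 3 ∧
      IsTrivialHyperplane 3 (formHyperplane (assocForm h)) (formRadical (assocForm h)) ∧
      upperRadical (formHyperplane (assocForm h)) =
        {X : Submodule K V | Module.finrank K X = 2 ∧ X ⊓ formRadical (assocForm h) ≠ ⊥}) ∧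
    -- type T2
    (HasTypeT2 E h →
      formRank (assocForm h) = 5 ∧
      Module.finrank K (formRadical (assocForm h)) = 1 ∧
      lowerRadical (formHyperplane (assocForm h)) = {formRadical (assocForm h)} ∧
      ∃ (V' V₀ : Submodule K V) (hc : IsCompl V' (formRadical (assocForm h)))
        (β : V₀ [⋀^Fin 2]→ₗ[K] K),
        V₀ ≤ V' ∧ Module.finrank K V₀ = 4 ∧ formRadical β = ⊥ ∧
        IsTrivialExtension 3 (formHyperplane (assocForm h)) V' (formRadical (assocForm h))
          (expansion 3 V' V₀ (subspaceHyperplane V₀ β)) ∧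
        upperRadical (formHyperplane (assocForm h)) =
          {X : Submodule K V | Module.finrank K X = 2 ∧
            (formRadical (assocForm h) ≤ X ∨
              X.map (V'.projection (formRadical (assocForm h)) hc) ∈
                subspaceHyperplane V₀ β)}) ∧
    -- type T3
    (HasTypeT3 E h →
      formRank (assocForm h) = 6 ∧
      ∃ V₁ V₂ : Submodule K V, IsCompl V₁ V₂ ∧
        Module.finrank K V₁ = 3 ∧ Module.finrank K V₂ = 3 ∧
        upperRadical (formHyperplane (assocForm h)) =
          {X : Submodule K V | ∃ x ∈ V₁, ∃ y ∈ V₂, x ≠ 0 ∧ y ≠ 0 ∧ X = Submodule.span K {x, y}}) ∧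
    -- type T4
    (HasTypeT4 E h →
      formRank (assocForm h) = 6 ∧
      ∃ (V₁ V₂ : Submodule K V) (ω : V₁ ≃ₗ[K] V₂), IsCompl V₁ V₂ ∧
        Module.finrank K V₁ = 3 ∧ Module.finrank K V₂ = 3 ∧
        upperRadical (formHyperplane (assocForm h)) =
          {X : Submodule K V | ∃ (x : V₁) (y : V₂), x ≠ 0 ∧
            X = Submodule.span K {(x : V) + (y : V), (ω x : V)}} ∪
          {X : Submodule K V | Module.finrank K X = 2 ∧ X ≤ V₂}) ∧
    -- types T10
    ((∃ c : K, HasTypeT10₁ E c h ∨ HasTypeT10₂ E c h) →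
      formRank (assocForm h) = 6 ∧
      IsDesarguesianLineSpread (upperRadical (formHyperplane (assocForm h)))) := by
  have h6 := finrank_eq_six E
  have hinv : ∀ (c : K), c ≠ 0 → ∀ g : Module.Dual K (⋀[K]^3 V),
      formHyperplane (assocForm (c • g)) = formHyperplane (assocForm g) ∧
      formRadical (assocForm (c • g)) = formRadical (assocForm g) ∧
      formRank (assocForm (c • g)) = formRank (assocForm g) := fun c hc g => by
    rw [assocForm_smul]
    exact ⟨formHyperplane_smul hc _, formRadical_smul hc _, formRank_smul hc _⟩
  have hmodel : ∀ {M : Module.Basis (Fin 6) K V → Module.Dual K (⋀[K]^3 V)}, IsNatural M →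
      (∃ B, assocForm h = assocForm (M B)) → SameType h (M E) := fun hM ⟨B, hB⟩ =>
    (hM.sameType_iff E h).2 ⟨B, 1, one_ne_zero, by rw [one_smul, assocForm_injective hB]⟩
  refine ⟨?_, fun hT => ?_, fun hT => ?_, fun hT => ?_, fun hT => ?_, ?_⟩
  · by_cases h2 : ∃ v p q, IsRankTwo (tri (assocForm h)) v p q
    · obtain ⟨v, p, q, h2⟩ := h2
      obtain ⟨B, hB | hB | hB | hB⟩ := h2.hasModel h6
      · exact .inl (hmodel isNatural_modelT1 ⟨B, hB⟩)
      · exact .inr (.inl (hmodel isNatural_modelT2 ⟨B, hB⟩))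
      · exact .inr (.inr (.inl (hmodel isNatural_modelT3 ⟨B, hB⟩)))
      · exact .inr (.inr (.inr (.inl (hmodel isNatural_modelT4 ⟨B, hB⟩))))
    · push Not at h2
      have h0 : assocForm h ≠ 0 := fun e => hne (assocForm_injective (e.trans rfl))
      obtain ⟨c, B, ⟨hc, hB⟩ | ⟨hc2, hc, hB⟩⟩ := exists_modelT10 h6 h0 h2
      · exact .inr (.inr (.inr (.inr ⟨c, .inl ⟨hc, hmodel (isNatural_modelT10₁ c) ⟨B, hB⟩⟩⟩)))
      · exact .inr (.inr (.inr (.inr ⟨c, .inr ⟨hc2, hc,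
          hmodel (isNatural_modelT10₂ c) ⟨B, hB⟩⟩⟩)))
  · obtain ⟨B, c, hc, rfl⟩ := (isNatural_modelT1.sameType_iff E h).1 hT
    obtain ⟨e1, e2, e3⟩ := hinv c hc (modelT1 B)
    rw [e1, e2, e3]
    exact ⟨formRank_modelT1 B, isTrivialHyperplane_modelT1 B, upperRadical_modelT1 B⟩
  · obtain ⟨B, c, hc, rfl⟩ := (isNatural_modelT2.sameType_iff E h).1 hT
    obtain ⟨e1, e2, e3⟩ := hinv c hc (modelT2 B)
    rw [e1, e2, e3]
    exact ⟨formRank_modelT2 B, finrank_formRadical_modelT2 B, lowerRadical_modelT2 B,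
      complT2 B, coreT2 B, isCompl_complT2 B, symplecticT2 B, inf_le_left, finrank_coreT2 B,
      formRadical_symplecticT2 B, isTrivialExtension_modelT2 B, upperRadical_modelT2 B⟩
  · obtain ⟨B, c, hc, rfl⟩ := (isNatural_modelT3.sameType_iff E h).1 hT
    obtain ⟨e1, -, e3⟩ := hinv c hc (modelT3 B)
    rw [e1, e3]
    exact ⟨formRank_eq_six B (formRadical_modelT3 B), _, _, isCompl_ker_tail_ker_head B,
      finrank_ker_of_surjective B (tail_surjective B),
      finrank_ker_of_surjective B (head_surjective B), upperRadical_modelT3 B⟩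
  · obtain ⟨B, c, hc, rfl⟩ := (isNatural_modelT4.sameType_iff E h).1 hT
    obtain ⟨e1, -, e3⟩ := hinv c hc (modelT4 B)
    rw [e1, e3]
    exact ⟨formRank_eq_six B (formRadical_modelT4 B), _, _, shift B,
      isCompl_ker_tail_ker_head B, finrank_ker_of_surjective B (tail_surjective B),
      finrank_ker_of_surjective B (head_surjective B), upperRadical_modelT4 B⟩
  · rintro ⟨c, ⟨hirr, hT⟩ | ⟨hchar, hirr, hT⟩⟩
    · obtain ⟨B, d, hd, rfl⟩ := ((isNatural_modelT10₁ c).sameType_iff E h).1 hT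
      obtain ⟨e1, -, e3⟩ := hinv d hd (modelT10₁ B c)
      rw [e1, e3]
      exact modelT10₁_properties B hirr
    · obtain ⟨B, d, hd, rfl⟩ := ((isNatural_modelT10₂ c).sameType_iff E h).1 hT
      obtain ⟨e1, -, e3⟩ := hinv d hd (modelT10₂ B c)
      rw [e1, e3]
      exact modelT10₂_properties B hirr
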